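/- Write points of $\mathbb{C}^2$ as $(z,\zeta)$. For a real-valued function $F$, real-analytic near $0\in\mathbb{C}^2$, write its Taylor expansion as $$F=\sum_{a,b,c,d\ge 0}\frac{F_{a,b,c,d}}{a!\,b!\,c!\,d!}\,z^a\zeta^b\bar z^c\bar\zeta^d .$$ Let $\mathcal{H}$ be the space of (germs at the origin of) graphed hypersurfaces $\{\operatorname{Re} w=F(z,\zeta,\bar z,\bar\zeta)\}\subset\mathbb{C}^3$, where $F$ is real-valued and real-analytic near $0$, such that - $F(0)=0$, and $F_{a,b,0,0}=0$ for all $a,b\ge 0$ (no harmonic monomials); - the Levi matrix $\begin{pmatrix}F_{z\bar z}&F_{z\bar\zeta}\\F_{\zeta\bar z}&F_{\zeta\bar\zeta}\end{pmatrix}$ has rank $1$ at every point near $0$; - (2-nondegeneracy) the matrix $\begin{pmatrix}F_{z\bar z}&F_{z\bar\zeta}\\F_{zz\bar z}&F_{zz\bar\zeta}\end{pmatrix}$ is invertible at the origin. Let $RT$ be the group of germs of rigid transformations $(z,\zeta,w)\mapsto(f(z,\zeta),g(z,\zeta),\rho w)$, where $\rho\in\mathbb{R}\setminus\{0\}$ and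 $f,g$ are holomorphic near $0\in\mathbb{C}^2$ with $f(0)=g(0)=0$ and with Jacobian matrix $\begin{pmatrix}f_z&f_\zeta\\g_z&g_\zeta\end{pmatrix}$ invertible at $0$. The element $(f,g,\rho)$ sends $\{\operatorname{Re} w=F\}$ to $\{\operatorname{Re} w'=F'\}$ when $$F'\big(f(z,\zeta),g(z,\zeta),\overline{f(z,\zeta)},\overline{g(z,\zeta)}\big)=\rho\,F(z,\zeta,\bar z,\bar\zeta)\quad\text{near } 0.$$ Let $\mathcal{H}^{(7)}\subset\mathcal{H}$ be the subspace of those elements with - $F_{a,b,1,0}=0$ for all $(a,b)\neq(1,0)$, and $F_{1,0,1,0}=1$; - $F_{a,b,2,0}=0$ for all $(a,b)\neq(0,1)$, and $F_{0,1,2,0}=1$; - $F_{3,0,0,1}=0$ and $F_{3,0,1,1}=F_{1,1,3,0}$. **Theorem 10.10.** Every element of $\mathcal{H}$ can be sent to some element of $\mathcal{H}^{(7)}$ by some element of $RT$. This element of $RT$ is not unique: for every element of $RT$ which sends the given hypersurface into $\mathcal{H}^{(7)}$ there is a different one which also sends it into $\mathcal{H}^{(7)}$. Moreover, every $(f,g,\rho)\in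 RT$ sending an element of $\mathcal{H}^{(7)}$ to an element of $\mathcal{H}^{(7)}$ has the form $$f(z,\zeta)=re^{i\theta}z,\qquad g(z,\zeta)=e^{2i\theta}\zeta,\qquad \rho=r^2,$$ for some $r>0$ and $\theta\in\mathbb{R}$. -/

import Mathlib

open Filter Topology

noncomputable section

namespace RigidCR

/-! Points of `ℂ²` are pairs `p = (z, ζ)`.  The four Wirtinger derivations act on functions
`G : ℂ × ℂ → ℂ`, real differentiability being understood. -/

/-- `∂G/∂z = (∂G/∂x - i ∂G/∂y) / 2`, where `z = x + i y`. -/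
def dz (G : ℂ × ℂ → ℂ) (p : ℂ × ℂ) : ℂ :=
  (1 / 2) * (fderiv ℝ G p (1, 0) - Complex.I * fderiv ℝ G p (Complex.I, 0))

/-- `∂G/∂ζ`. -/
def dzeta (G : ℂ × ℂ → ℂ) (p : ℂ × ℂ) : ℂ :=
  (1 / 2) * (fderiv ℝ G p (0, 1) - Complex.I * fderiv ℝ G p (0, Complex.I))

/-- `∂G/∂z̄ = (∂G/∂x + i ∂G/∂y) / 2`, where `z = x + i y`. -/
def dzBar (G : ℂ × ℂ → ℂ) (p : ℂ × ℂ) : ℂ :=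
  (1 / 2) * (fderiv ℝ G p (1, 0) + Complex.I * fderiv ℝ G p (Complex.I, 0))

/-- `∂G/∂ζ̄`. -/
def dzetaBar (G : ℂ × ℂ → ℂ) (p : ℂ × ℂ) : ℂ :=
  (1 / 2) * (fderiv ℝ G p (0, 1) + Complex.I * fderiv ℝ G p (0, Complex.I))

/-- The mixed derivative `∂_z^a ∂_ζ^b ∂_z̄^c ∂_ζ̄^d F` of a real-valued function `F`. -/
def mixedDeriv (F : ℂ × ℂ → ℝ) (a b c d : ℕ) : ℂ × ℂ → ℂ :=
  dz^[a] (dzeta^[b] (dzBar^[c] (dzetaBar^[d] (fun p => (F p : ℂ)))))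

/-- The coefficient `F_{a,b,c,d}` of the Taylor expansion
`F = ∑ F_{a,b,c,d} / (a! b! c! d!) z^a ζ^b z̄^c ζ̄^d` at the origin. -/
def coeff (F : ℂ × ℂ → ℝ) (a b c d : ℕ) : ℂ := mixedDeriv F a b c d 0

/-- The Levi matrix of the hypersurface `Re w = F(z, ζ)`. -/
def leviMatrix (F : ℂ × ℂ → ℝ) (p : ℂ × ℂ) : Matrix (Fin 2) (Fin 2) ℂ :=
  !![mixedDeriv F 1 0 1 0 p, mixedDeriv F 1 0 0 1 p;
     mixedDeriv F 0 1 1 0 p, mixedDeriv F 0 1 0 1 p]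

/-- The space `ℋ` of graphed hypersurfaces `Re w = F(z, ζ, z̄, ζ̄)` through the origin which have
Levi rank 1 everywhere and are 2-nondegenerate, given by their graphing functions.  Only the germ
of `F` at the origin matters. -/
structure MemH (F : ℂ × ℂ → ℝ) : Prop where
  analytic : AnalyticAt ℝ F 0
  map_zero : F 0 = 0
  /-- no harmonic monomials -/
  no_harmonic : ∀ a b : ℕ, coeff F a b 0 0 = 0
  levi_rank_one : ∀ᶠ p in 𝓝 (0 : ℂ × ℂ), (leviMatrix F p).rank = 1
  two_nondegenerate :
    IsUnit !![coeff F 1 0 1 0, coeff F 1 0 0 1; coeff F 2 0 1 0, coeff F 2 0 0 1]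

/-- The normalized subspace `ℋ⁽⁷⁾` of `ℋ`. -/
structure MemH7 (F : ℂ × ℂ → ℝ) : Prop extends MemH F where
  coeff_one : ∀ a b : ℕ, (a, b) ≠ (1, 0) → coeff F a b 1 0 = 0
  coeff_1010 : coeff F 1 0 1 0 = 1
  coeff_two : ∀ a b : ℕ, (a, b) ≠ (0, 1) → coeff F a b 2 0 = 0
  coeff_0120 : coeff F 0 1 2 0 = 1
  coeff_3001 : coeff F 3 0 0 1 = 0
  coeff_3011 : coeff F 3 0 1 1 = coeff F 1 1 3 0

/-- A rigid transformation `(z, ζ, w) ↦ (f(z, ζ), g(z, ζ), ρ w)` fixing the origin, where `f`, `g`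
are holomorphic near `0 ∈ ℂ²` with invertible Jacobian matrix at `0`, and `ρ ∈ ℝ*`.
Only the germs of `f` and `g` at the origin matter. -/
structure RigidTransformation where
  f : ℂ × ℂ → ℂ
  g : ℂ × ℂ → ℂ
  ρ : ℝ
  f_analytic : AnalyticAt ℂ f 0
  g_analytic : AnalyticAt ℂ g 0
  f_zero : f 0 = 0
  g_zero : g 0 = 0
  jacobian : IsUnit !![fderiv ℂ f 0 (1, 0), fderiv ℂ f 0 (0, 1);
                       fderiv ℂ g 0 (1, 0), fderiv ℂ g 0 (0, 1)]
  ρ_ne_zero : ρ ≠ 0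

namespace RigidTransformation

/-- `(f, g, ρ)` sends the hypersurface `Re w = F` to the hypersurface `Re w' = F'`: the fundamental
equation `F'(f, g) = ρ F` holds near the origin. -/
def Sends (T : RigidTransformation) (F F' : ℂ × ℂ → ℝ) : Prop :=
  ∀ᶠ p in 𝓝 (0 : ℂ × ℂ), F' (T.f p, T.g p) = T.ρ * F p

/-- Two triples represent the same germ of rigid transformation, that is, the same element of the
group of rigid transformations fixing the origin. -/
def SameGerm (T T' : RigidTransformation) : Prop :=
  T.f =ᶠ[𝓝 0] T'.f ∧ T.g =ᶠ[𝓝 0] T'.g ∧ T.ρ = T'.ρ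

end RigidTransformation

end RigidCR

end

/-! Write F(p) = Φ(p, p̄) with Φ holomorphic near 0 in ℂ² × ℂ². The subspace q = p̄ is totally real,
so analytic identities for F extend to Φ. The problem then concerns four holomorphic germs on ℂ²,
barred derivatives of Φ at q = 0: A = `jet Φ 1 0`, D = `jet Φ 0 1`, C = `jet Φ 2 0`, E = `jet Φ 1
1`. Below, subscripts are derivatives in z and ζ, and primes mark the target hypersurface. By
Hermitian symmetry (`coeff_conj`), membership in ℋ⁽⁷⁾ amounts to A = z, C = ζ, D_zzz(0) = 0 and
E_zzz(0) real (`IsNormal`).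

Two mechanisms carry the proof. The Levi determinant and its z̄-derivative vanish at q = 0; once A =
z, this says D_ζ = 0 and E_ζ = D_z C_ζ (`IsGraph1.pY_D`, `IsGraph1.pY_E`). Differentiating F'(f, g)
= ρF once and twice in the barred variables at q = 0 gives linear relations between the jets of F
and those of F' along (f, g), with coefficients the conjugated derivatives of f and g at 0
(`Sends.jet_first`, `Sends.jet_second`).

Existence: f = A makes A' = z, and 2-nondegeneracy becomes D'_zz(0) ≠ 0. Next f = z - cD with a
linear g yields D'_zz(0) = 1 and D'_zzz(0) = 0. Finally g = C - κ̄D with κ + κ̄ = C_zz(0) makes C' =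
ζ, and the free imaginary part of κ makes E'_zzz(0) real.

Rigidity: between normal forms the first-order relations force f = αz and ρ = αᾱ. The second-order
ones give g up to a multiple of D governed by κ = g_zz(0): the C-relation makes ᾱ²κ imaginary, the
E-relation makes it real, so κ = 0 and g = (α/ᾱ)ζ. Non-uniqueness comes from composing with the
dilation (2z, ζ, 4w). -/

noncomputable section

namespace RigidCR

/-! ### Calculus of directional derivatives of holomorphic germs -/

section PartialDerivatives

variable {E : Type*} [NormedAddCommGroup E] [NormedSpace ℂ E]

/-- The complex derivative of `u` in the direction `v`. -/
def pd (v : E) (u : E → ℂ) (x : E) : ℂ := fderiv ℂ u x v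

theorem analyticAt_pd {u : E → ℂ} {x : E} (hu : AnalyticAt ℂ u x) (v : E) :
    AnalyticAt ℂ (pd v u) x :=
  ((ContinuousLinearMap.apply ℂ ℂ v).analyticAt _).comp hu.fderiv

theorem analyticAt_iterate_pd {u : E → ℂ} {x : E} (hu : AnalyticAt ℂ u x) (v : E) (n : ℕ) :
    AnalyticAt ℂ ((pd v)^[n] u) x := by
  induction n with
  | zero => exact hu
  | succ n ih =>
    rw [Function.iterate_succ_apply']
    exact analyticAt_pd ih v

theorem pd_congr {u w : E → ℂ} {x : E} (h : u =ᶠ[𝓝 x] w) (v : E) : pd v u =ᶠ[𝓝 x] pd v w := by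
  filter_upwards [h.fderiv (𝕜 := ℂ)] with y hy
  simp [pd, hy]

theorem iterate_pd_congr {u w : E → ℂ} {x : E} (h : u =ᶠ[𝓝 x] w) (v : E) (n : ℕ) :
    (pd v)^[n] u =ᶠ[𝓝 x] (pd v)^[n] w := by
  induction n with
  | zero => exact h
  | succ n ih =>
    rw [Function.iterate_succ_apply', Function.iterate_succ_apply']
    exact pd_congr ih v

theorem pd_congr_at {u w : E → ℂ} {x : E} (h : ∀ᶠ y in 𝓝 x, u y = w y) (v : E) :
    pd v u x = pd v w x := (pd_congr h v).eq_of_nhds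

theorem pd_add {u w : E → ℂ} {x : E} (hu : AnalyticAt ℂ u x) (hw : AnalyticAt ℂ w x) (v : E) :
    pd v (fun y => u y + w y) x = pd v u x + pd v w x := by
  simp [pd, fderiv_fun_add hu.differentiableAt hw.differentiableAt]

theorem pd_sub {u w : E → ℂ} {x : E} (hu : AnalyticAt ℂ u x) (hw : AnalyticAt ℂ w x) (v : E) :
    pd v (fun y => u y - w y) x = pd v u x - pd v w x := by
  simp [pd, fderiv_fun_sub hu.differentiableAt hw.differentiableAt]

theorem pd_mul {u w : E → ℂ} {x : E} (hu : AnalyticAt ℂ u x) (hw : AnalyticAt ℂ w x) (v : E) :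
    pd v (fun y => u y * w y) x = pd v u x * w x + u x * pd v w x := by
  simp [pd, fderiv_fun_mul hu.differentiableAt hw.differentiableAt]
  ring

theorem pd_const (c : ℂ) (v x : E) : pd v (fun _ => c) x = 0 := by
  simp [pd]

theorem pd_const_mul {u : E → ℂ} {x : E} (c : ℂ) (hu : AnalyticAt ℂ u x) (v : E) :
    pd v (fun y => c * u y) x = c * pd v u x := by
  rw [pd_mul analyticAt_const hu, pd_const]; ring

theorem pd_clm (L : E →L[ℂ] ℂ) (v x : E) : pd v (fun y => L y) x = L v := by
  simp [pd]

theorem pd_smul (c : ℂ) (v : E) (u : E → ℂ) (x : E) : pd (c • v) u x = c * pd v u x := by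
  simp [pd]

theorem pd_add_dir (v w : E) (u : E → ℂ) (x : E) : pd (v + w) u x = pd v u x + pd w u x := by
  simp [pd]

theorem pd_comm {u : E → ℂ} {x : E} (hu : AnalyticAt ℂ u x) (v w : E) :
    pd v (pd w u) =ᶠ[𝓝 x] pd w (pd v u) := by
  have key : ∀ y, AnalyticAt ℂ u y → ∀ a b : E,
      pd a (pd b u) y = fderiv ℂ (fderiv ℂ u) y a b := by
    intro y hy a b
    have h1 : HasFDerivAt (fun z => fderiv ℂ u z b)
        ((ContinuousLinearMap.apply ℂ ℂ b).comp (fderiv ℂ (fderiv ℂ u) y)) y :=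
      (ContinuousLinearMap.apply ℂ ℂ b).hasFDerivAt.comp y hy.fderiv.differentiableAt.hasFDerivAt
    have : pd b u = fun z => fderiv ℂ u z b := rfl
    rw [pd, this, h1.fderiv]
    simp
  filter_upwards [hu.eventually_analyticAt] with y hy
  rw [key y hy, key y hy]
  exact (hy.contDiffAt (n := ⊤)).isSymmSndFDerivAt (by simp) v w

theorem pd_comm_at {u : E → ℂ} {x : E} (hu : AnalyticAt ℂ u x) (v w : E) :
    pd v (pd w u) x = pd w (pd v u) x := (pd_comm hu v w).eq_of_nhds

theorem pd_iterate_comm {u : E → ℂ} {x : E} (hu : AnalyticAt ℂ u x) (v w : E) (n : ℕ) :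
    pd v ((pd w)^[n] u) =ᶠ[𝓝 x] (pd w)^[n] (pd v u) := by
  induction n with
  | zero => rfl
  | succ n ih =>
    rw [Function.iterate_succ_apply', Function.iterate_succ_apply']
    exact (pd_comm (analyticAt_iterate_pd hu w n) v w).trans (pd_congr ih w)

theorem iterate_pd_comm {u : E → ℂ} {x : E} (hu : AnalyticAt ℂ u x) (v w : E) (m n : ℕ) :
    (pd v)^[m] ((pd w)^[n] u) =ᶠ[𝓝 x] (pd w)^[n] ((pd v)^[m] u) := by
  induction m with
  | zero => rfl
  | succ m ih =>
    rw [Function.iterate_succ_apply', Function.iterate_succ_apply']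
    exact (pd_congr ih v).trans (pd_iterate_comm (analyticAt_iterate_pd hu v m) v w n)

variable {E' : Type*} [NormedAddCommGroup E'] [NormedSpace ℂ E']

theorem pd_comp_clm {u : E' → ℂ} {L : E →L[ℂ] E'} {x : E} (hu : AnalyticAt ℂ u (L x)) (v : E) :
    pd v (fun y => u (L y)) x = pd (L v) u (L x) := by
  have : HasFDerivAt (fun y => u (L y)) ((fderiv ℂ u (L x)).comp L) x :=
    hu.differentiableAt.hasFDerivAt.comp x L.hasFDerivAt
  simp [pd, this.fderiv]

theorem pd_comp {u : E' → ℂ} {h : E → E'} {h' : E →L[ℂ] E'} {x : E} (hu : AnalyticAt ℂ u (h x))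
    (hh : HasFDerivAt h h' x) (v : E) :
    pd v (fun y => u (h y)) x = pd (h' v) u (h x) := by
  have : HasFDerivAt (fun y => u (h y)) ((fderiv ℂ u (h x)).comp h') x :=
    hu.differentiableAt.hasFDerivAt.comp x hh
  simp [pd, this.fderiv]

end PartialDerivatives

/-- `∂/∂z` on holomorphic functions of `(z, ζ)`. -/
abbrev pX (u : ℂ × ℂ → ℂ) : ℂ × ℂ → ℂ := pd ((1, 0) : ℂ × ℂ) u

/-- `∂/∂ζ` on holomorphic functions of `(z, ζ)`. -/
abbrev pY (u : ℂ × ℂ → ℂ) : ℂ × ℂ → ℂ := pd ((0, 1) : ℂ × ℂ) u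

theorem pd_pair (u : ℂ × ℂ → ℂ) (a b : ℂ) (x : ℂ × ℂ) :
    pd (a, b) u x = pX u x * a + pY u x * b := by
  have : ((a, b) : ℂ × ℂ) = a • (1, 0) + b • (0, 1) := by simp
  rw [this, pd_add_dir, pd_smul, pd_smul]; ring

theorem pd_comp_pair {E : Type*} [NormedAddCommGroup E] [NormedSpace ℂ E]
    {u : ℂ × ℂ → ℂ} {f g : E → ℂ} {x : E}
    (hu : AnalyticAt ℂ u (f x, g x)) (hf : AnalyticAt ℂ f x) (hg : AnalyticAt ℂ g x) (v : E) :
    pd v (fun y => u (f y, g y)) x =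
      pX u (f x, g x) * pd v f x + pY u (f x, g x) * pd v g x := by
  rw [pd_comp (h := fun y => (f y, g y)) hu
    (hf.differentiableAt.hasFDerivAt.prodMk hg.differentiableAt.hasFDerivAt)]
  exact pd_pair _ _ _ _

theorem pX_fst (x : ℂ × ℂ) : pX (fun p => p.1) x = 1 :=
  pd_clm (ContinuousLinearMap.fst ℂ ℂ ℂ) _ _

theorem pY_fst (x : ℂ × ℂ) : pY (fun p => p.1) x = 0 :=
  pd_clm (ContinuousLinearMap.fst ℂ ℂ ℂ) _ _

theorem pX_snd (x : ℂ × ℂ) : pX (fun p => p.2) x = 0 :=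
  pd_clm (ContinuousLinearMap.snd ℂ ℂ ℂ) _ _

theorem pY_snd (x : ℂ × ℂ) : pY (fun p => p.2) x = 1 :=
  pd_clm (ContinuousLinearMap.snd ℂ ℂ ℂ) _ _

/-! ### Chain rules on ℂ² up to third order -/

section ChainRules

variable {u f g : ℂ × ℂ → ℂ} {x : ℂ × ℂ}

theorem eventually_analyticAt_comp (hu : AnalyticAt ℂ u (f x, g x)) (hf : AnalyticAt ℂ f x)
    (hg : AnalyticAt ℂ g x) :
    ∀ᶠ y in 𝓝 x, AnalyticAt ℂ u (f y, g y) ∧ AnalyticAt ℂ f y ∧ AnalyticAt ℂ g y := by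
  have h : Tendsto (fun y => (f y, g y)) (𝓝 x) (𝓝 (f x, g x)) :=
    (hf.continuousAt.prodMk hg.continuousAt)
  exact (h.eventually hu.eventually_analyticAt).and
    (hf.eventually_analyticAt.and hg.eventually_analyticAt)

theorem analyticAt_comp_pair {E : Type*} [NormedAddCommGroup E] [NormedSpace ℂ E]
    {f g : E → ℂ} {x : E} (hu : AnalyticAt ℂ u (f x, g x)) (hf : AnalyticAt ℂ f x)
    (hg : AnalyticAt ℂ g x) : AnalyticAt ℂ (fun y => u (f y, g y)) x :=
  AnalyticAt.fun_comp hu (hf.prod hg)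

theorem pXX_comp (hu : AnalyticAt ℂ u (f x, g x)) (hf : AnalyticAt ℂ f x)
    (hg : AnalyticAt ℂ g x) :
    pX (pX (fun y => u (f y, g y))) x =
      pX (pX u) (f x, g x) * pX f x ^ 2 + 2 * pX (pY u) (f x, g x) * pX f x * pX g x
        + pY (pY u) (f x, g x) * pX g x ^ 2 + pX u (f x, g x) * pX (pX f) x
        + pY u (f x, g x) * pX (pX g) x := by
  have h1 : ∀ᶠ y in 𝓝 x, pX (fun y => u (f y, g y)) y =
      pX u (f y, g y) * pX f y + pY u (f y, g y) * pX g y := by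
    filter_upwards [eventually_analyticAt_comp hu hf hg] with y hy
    exact pd_comp_pair hy.1 hy.2.1 hy.2.2 _
  have hX := analyticAt_pd hu (1, 0)
  have hY := analyticAt_pd hu (0, 1)
  have hfX := analyticAt_pd hf (1, 0)
  have hgX := analyticAt_pd hg (1, 0)
  simp only [pX, pY] at h1 ⊢
  rw [pd_congr_at h1, pd_add ((analyticAt_comp_pair hX hf hg).fun_mul hfX)
    ((analyticAt_comp_pair hY hf hg).fun_mul hgX), pd_mul (analyticAt_comp_pair hX hf hg) hfX,
    pd_mul (analyticAt_comp_pair hY hf hg) hgX, pd_comp_pair hX hf hg, pd_comp_pair hY hf hg,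
    pX, pX, pY, pY, pd_comm_at hu (0, 1) (1, 0)]
  ring

theorem pXXX_comp (hu : AnalyticAt ℂ u (f x, g x)) (hf : AnalyticAt ℂ f x)
    (hg : AnalyticAt ℂ g x) :
    pX (pX (pX (fun y => u (f y, g y)))) x =
      pX (pX (pX u)) (f x, g x) * pX f x ^ 3
        + 3 * pX (pX (pY u)) (f x, g x) * pX f x ^ 2 * pX g x
        + 3 * pX (pY (pY u)) (f x, g x) * pX f x * pX g x ^ 2
        + pY (pY (pY u)) (f x, g x) * pX g x ^ 3
        + 3 * pX (pX u) (f x, g x) * pX f x * pX (pX f) x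
        + 3 * pX (pY u) (f x, g x) * (pX (pX f) x * pX g x + pX f x * pX (pX g) x)
        + 3 * pY (pY u) (f x, g x) * pX g x * pX (pX g) x
        + pX u (f x, g x) * pX (pX (pX f)) x + pY u (f x, g x) * pX (pX (pX g)) x := by
  have h1 : ∀ᶠ y in 𝓝 x, pX (fun y => u (f y, g y)) y =
      pX u (f y, g y) * pX f y + pY u (f y, g y) * pX g y := by
    filter_upwards [eventually_analyticAt_comp hu hf hg] with y hy
    exact pd_comp_pair hy.1 hy.2.1 hy.2.2 _
  have hX := analyticAt_pd hu (1, 0)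
  have hY := analyticAt_pd hu (0, 1)
  have hfX := analyticAt_pd hf (1, 0)
  have hgX := analyticAt_pd hg (1, 0)
  have h2 : ∀ᶠ y in 𝓝 x, pX (pX (fun y => u (f y, g y))) y =
      pX (fun y => pX u (f y, g y)) y * pX f y + pX u (f y, g y) * pX (pX f) y
      + (pX (fun y => pY u (f y, g y)) y * pX g y + pY u (f y, g y) * pX (pX g) y) := by
    filter_upwards [eventually_analyticAt_comp hu hf hg, h1.eventually_nhds] with y hy h1y
    have hX := analyticAt_pd hy.1 (1, 0)
    have hY := analyticAt_pd hy.1 (0, 1)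
    have hfX := analyticAt_pd hy.2.1 (1, 0)
    have hgX := analyticAt_pd hy.2.2 (1, 0)
    rw [pX, pd_congr_at h1y, pd_add ((analyticAt_comp_pair hX hy.2.1 hy.2.2).fun_mul hfX)
      ((analyticAt_comp_pair hY hy.2.1 hy.2.2).fun_mul hgX),
      pd_mul (analyticAt_comp_pair hX hy.2.1 hy.2.2) hfX,
      pd_mul (analyticAt_comp_pair hY hy.2.1 hy.2.2) hgX]
  have hXc := analyticAt_comp_pair hX hf hg
  have hYc := analyticAt_comp_pair hY hf hg
  have hXcX := analyticAt_pd hXc (1, 0)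
  have hYcX := analyticAt_pd hYc (1, 0)
  have hfXX := analyticAt_pd hfX (1, 0)
  have hgXX := analyticAt_pd hgX (1, 0)
  have c1 : pX (pY (pX u)) (f x, g x) = pX (pX (pY u)) (f x, g x) :=
    pd_congr_at (pd_comm hu (0, 1) (1, 0)) _
  have c2 : pY (pX u) (f x, g x) = pX (pY u) (f x, g x) := pd_comm_at hu _ _
  have c3 : pY (pY (pX u)) (f x, g x) = pX (pY (pY u)) (f x, g x) :=
    (pd_congr_at (pd_comm hu (0, 1) (1, 0)) _).trans (pd_comm_at hY _ _)
  have e1 := pXX_comp hX hf hg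
  have e2 := pXX_comp hY hf hg
  simp only [pX, pY] at h2 e1 e2 c1 c2 c3 ⊢
  rw [pd_congr_at h2, pd_add ((hXcX.fun_mul hfX).fun_add (hXc.fun_mul hfXX))
    ((hYcX.fun_mul hgX).fun_add (hYc.fun_mul hgXX)), pd_add (hXcX.fun_mul hfX) (hXc.fun_mul hfXX),
    pd_add (hYcX.fun_mul hgX) (hYc.fun_mul hgXX), pd_mul hXcX hfX, pd_mul hXc hfXX, pd_mul hYcX hgX,
    pd_mul hYc hgXX, e1, e2, pd_comp_pair hX hf hg,
    pd_comp_pair hY hf hg]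
  simp only [pX, pY, c1, c2, c3]
  ring

end ChainRules

/-! ### Identity principles -/

section Uniqueness

/-- A holomorphic germ of one variable all of whose derivatives vanish is zero. -/
theorem eventually_eq_zero_of_iteratedDeriv {h : ℂ → ℂ} {x : ℂ} (hh : AnalyticAt ℂ h x)
    (h0 : ∀ n, iteratedDeriv n h x = 0) : ∀ᶠ t in 𝓝 x, h t = 0 := by
  have := hh.hasFPowerSeriesAt
  have hz : FormalMultilinearSeries.ofScalars ℂ
      (fun n => iteratedDeriv n h x / n.factorial) = 0 := by
    ext n
    simp [h0, FormalMultilinearSeries.ofScalars]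
  rw [hz] at this
  exact this.eventually_eq_zero

theorem hasDerivAt_along {E : Type*} [NormedAddCommGroup E] [NormedSpace ℂ E] {u : E → ℂ}
    {v x : E} {t : ℂ} (hu : AnalyticAt ℂ u (x + t • v)) :
    HasDerivAt (fun t : ℂ => u (x + t • v)) (pd v u (x + t • v)) t := by
  have h : HasDerivAt (fun t : ℂ => x + t • v) v t := by
    simpa using ((hasDerivAt_id t).smul_const v).const_add x
  exact hu.differentiableAt.hasFDerivAt.comp_hasDerivAt t h

theorem analyticAt_along {E : Type*} [NormedAddCommGroup E] [NormedSpace ℂ E] {u : E → ℂ}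
    {v x : E} {t : ℂ} (hu : AnalyticAt ℂ u (x + t • v)) :
    AnalyticAt ℂ (fun t : ℂ => u (x + t • v)) t := by
  have h : AnalyticAt ℂ (fun t : ℂ => x + t • v) t := by fun_prop
  exact AnalyticAt.fun_comp hu h

theorem iteratedDeriv_along {E : Type*} [NormedAddCommGroup E] [NormedSpace ℂ E] {u : E → ℂ}
    {s : Set E} (hs : IsOpen s) (hu : AnalyticOnNhd ℂ u s) (v x : E) (n : ℕ) :
    ∀ t : ℂ, x + t • v ∈ s → iteratedDeriv n (fun t : ℂ => u (x + t • v)) t =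
      (pd v)^[n] u (x + t • v) := by
  induction n with
  | zero => simp
  | succ n ih =>
    intro t ht
    have hcont : Continuous fun t : ℂ => x + t • v := by fun_prop
    have hev : iteratedDeriv n (fun t : ℂ => u (x + t • v)) =ᶠ[𝓝 t]
        fun t => (pd v)^[n] u (x + t • v) := by
      filter_upwards [(hs.preimage hcont).mem_nhds ht] with y hy using ih y hy
    rw [iteratedDeriv_succ, hev.deriv_eq, Function.iterate_succ_apply']
    exact (hasDerivAt_along (analyticAt_iterate_pd (hu _ ht) v n)).deriv

/-- The parameters t for which x + tv stays in the ball form a convex, hence connected, set, so the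
one-variable identity theorem propagates vanishing from t = 0. -/
theorem eq_zero_along {E : Type*} [NormedAddCommGroup E] [NormedSpace ℂ E] {u : E → ℂ} {ε : ℝ}
    (hu : AnalyticOnNhd ℂ u (Metric.ball 0 ε)) {v x : E} (hx : x ∈ Metric.ball (0 : E) ε)
    (h0 : ∀ n, (pd v)^[n] u x = 0) {t : ℂ} (ht : x + t • v ∈ Metric.ball (0 : E) ε) :
    u (x + t • v) = 0 := by
  have hcont : Continuous fun t : ℂ => x + t • v := by fun_prop
  let U : Set ℂ := (fun t : ℂ => x + t • v) ⁻¹' Metric.ball (0 : E) ε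
  have hU : Convex ℝ U := by
    intro a ha b hb p q hp hq hpq
    have : x + (p • a + q • b) • v = p • (x + a • v) + q • (x + b • v) := by
      rw [smul_add, smul_add, add_smul, smul_assoc, smul_assoc]
      nth_rewrite 1 [← one_smul ℝ x]
      rw [← hpq, add_smul]
      abel
    simp only [U, Set.mem_preimage] at ha hb ⊢
    rw [this]
    exact convex_ball (0 : E) ε ha hb hp hq hpq
  have han : AnalyticOnNhd ℂ (fun t : ℂ => u (x + t • v)) U := fun t ht =>
    analyticAt_along (hu _ ht)
  have h0U : (0 : ℂ) ∈ U := by simpa [U] using hx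
  refine han.eqOn_zero_of_preconnected_of_eventuallyEq_zero hU.isPreconnected h0U ?_ ht
  refine eventually_eq_zero_of_iteratedDeriv (han 0 h0U) fun n => ?_
  rw [iteratedDeriv_along Metric.isOpen_ball hu v x n 0 h0U]
  simpa using h0 n

/-- Vanishing propagates in two moves: each ζ-derivative of u vanishes along the z-axis from the
origin to (z, 0), and then u vanishes along the ζ-direction from (z, 0) to (z, ζ). -/
theorem eventually_eq_zero_of_iterate_pd {u : ℂ × ℂ → ℂ} (hu : AnalyticAt ℂ u 0)
    (h : ∀ a b, pX^[a] (pY^[b] u) 0 = 0) : ∀ᶠ p in 𝓝 0, u p = 0 := by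
  obtain ⟨ε, hε, hball⟩ := Metric.eventually_nhds_iff_ball.1 hu.eventually_analyticAt
  have hball' : AnalyticOnNhd ℂ u (Metric.ball 0 ε) := hball
  filter_upwards [Metric.ball_mem_nhds 0 hε] with p hp
  have hp1 : ((p.1, 0) : ℂ × ℂ) ∈ Metric.ball (0 : ℂ × ℂ) ε := by
    rw [mem_ball_zero_iff] at hp ⊢
    exact lt_of_le_of_lt (by simp [Prod.norm_def]) hp
  have hp2 : p = (p.1, 0) + p.2 • ((0, 1) : ℂ × ℂ) := by ext <;> simp
  have hp3 : (p.1, 0) = (0 : ℂ × ℂ) + p.1 • ((1, 0) : ℂ × ℂ) := by ext <;> simp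
  rw [hp2]
  refine eq_zero_along hball' hp1 (fun b => ?_) (hp2 ▸ hp)
  rw [hp3]
  refine eq_zero_along (fun q hq => analyticAt_iterate_pd (hball q hq) _ _)
    (Metric.mem_ball_self hε) (fun a => h a b) (hp3 ▸ hp1)

theorem eventually_eq_of_iterate_pd {u w : ℂ × ℂ → ℂ} (hu : AnalyticAt ℂ u 0)
    (hw : AnalyticAt ℂ w 0) (h : ∀ a b, pX^[a] (pY^[b] u) 0 = pX^[a] (pY^[b] w) 0) :
    u =ᶠ[𝓝 0] w := by
  have hsub : ∀ (v : ℂ × ℂ) (n : ℕ) {u w : ℂ × ℂ → ℂ}, AnalyticAt ℂ u 0 → AnalyticAt ℂ w 0 →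
      (pd v)^[n] (fun p => u p - w p) =ᶠ[𝓝 0] fun p => (pd v)^[n] u p - (pd v)^[n] w p := by
    intro v n u w hu hw
    induction n with
    | zero => rfl
    | succ n ih =>
      simp only [Function.iterate_succ_apply']
      refine (pd_congr ih v).trans ?_
      filter_upwards [(analyticAt_iterate_pd hu v n).eventually_analyticAt,
        (analyticAt_iterate_pd hw v n).eventually_analyticAt] with y h1 h2
      exact pd_sub h1 h2 v
  have := eventually_eq_zero_of_iterate_pd (hu.fun_sub hw) (fun a b => by
    rw [((iterate_pd_congr (hsub _ b hu hw) _ a).trans (hsub _ a (analyticAt_iterate_pd hu _ b)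
      (analyticAt_iterate_pd hw _ b))).eq_of_nhds, h a b, sub_self])
  filter_upwards [this] with p hp using sub_eq_zero.1 hp

/-- Coordinatewise complex conjugation of `ℂ²`. -/
def bar : (ℂ × ℂ) →L[ℝ] (ℂ × ℂ) :=
  (Complex.conjCLE : ℂ →L[ℝ] ℂ).prodMap (Complex.conjCLE : ℂ →L[ℝ] ℂ)

@[simp] theorem bar_apply (p : ℂ × ℂ) :
    bar p = (starRingEnd ℂ p.1, starRingEnd ℂ p.2) := rfl

theorem bar_bar (p : ℂ × ℂ) : bar (bar p) = p := by simp

theorem bar_smul (c : ℂ) (p : ℂ × ℂ) : bar (c • p) = starRingEnd ℂ c • bar p := by simp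

/-- A holomorphic germ on `ℂ² × ℂ²` which vanishes on the totally real subspace `q = p̄` is
zero. -/
theorem eventually_eq_zero_of_bar {Ψ : (ℂ × ℂ) × (ℂ × ℂ) → ℂ} (hΨ : AnalyticAt ℂ Ψ 0)
    (h : ∀ᶠ p in 𝓝 0, Ψ (p, bar p) = 0) : ∀ᶠ x in 𝓝 0, Ψ x = 0 := by
  obtain ⟨ε, hε, hball⟩ := Metric.eventually_nhds_iff_ball.1 hΨ.eventually_analyticAt
  -- Every x lies on a complex line whose real points satisfy q = p̄: with a = (p + q̄)/2 and b = (p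
  -- - q̄)/(2i), the point (a, ā) + t(b, b̄) is on the totally real subspace for real t and equals x
  -- at t = i.
  let a : (ℂ × ℂ) × (ℂ × ℂ) → ℂ × ℂ := fun x => (1 / 2 : ℂ) • (x.1 + bar x.2)
  let b : (ℂ × ℂ) × (ℂ × ℂ) → ℂ × ℂ := fun x => (-Complex.I / 2) • (x.1 - bar x.2)
  have hac : Continuous a := by fun_prop
  have hbc : Continuous b := by fun_prop
  let L : (ℂ × ℂ) × (ℂ × ℂ) → ℂ → (ℂ × ℂ) × (ℂ × ℂ) := fun x t =>
    (a x, bar (a x)) + t • (b x, bar (b x))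
  have hI : ∀ x, L x Complex.I = x := by
    rintro ⟨⟨x1, x2⟩, ⟨x3, x4⟩⟩
    simp only [L, a, b]
    have h2 : (starRingEnd ℂ) 2 = 2 := Complex.conj_ofNat 2
    have hII := Complex.I_mul_I
    ext <;> simp [h2]
    · linear_combination (-(x1 - starRingEnd ℂ x3) / 2) * hII
    · linear_combination (-(x2 - starRingEnd ℂ x4) / 2) * hII
    · linear_combination ((starRingEnd ℂ x1 - x3) / 2) * hII
    · linear_combination ((starRingEnd ℂ x2 - x4) / 2) * hII
  have hreal : ∀ x, ∀ t : ℝ, L x t = (a x + (t : ℂ) • b x, bar (a x + (t : ℂ) • b x)) := by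
    intro x t
    simp only [L, map_add, bar_smul, Complex.conj_ofReal]
    rfl
  have hL0 : ∀ᶠ x in 𝓝 0, L x 0 ∈ Metric.ball (0 : (ℂ × ℂ) × (ℂ × ℂ)) ε := by
    have : Continuous fun x => L x 0 := by fun_prop
    refine this.continuousAt.eventually_mem (Metric.isOpen_ball.mem_nhds ?_)
    simpa [L, a, b] using hε
  have h0 : ∀ᶠ x in 𝓝 (0 : (ℂ × ℂ) × (ℂ × ℂ)), ∀ᶠ p in 𝓝 (a x), Ψ (p, bar p) = 0 := by
    have : Tendsto a (𝓝 0) (𝓝 0) := by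
      have := hac.tendsto 0
      rwa [show a 0 = 0 by simp [a]] at this
    exact this.eventually h.eventually_nhds
  filter_upwards [hL0, h0, Metric.ball_mem_nhds 0 hε] with x hx1 hx2 hx3
  let U : Set ℂ := L x ⁻¹' Metric.ball 0 ε
  have hU : Convex ℝ U := by
    intro s hs t ht p q hp hq hpq
    have : L x (p • s + q • t) = p • L x s + q • L x t := by
      simp only [L]
      rw [smul_add, smul_add, add_smul, smul_assoc, smul_assoc]
      nth_rewrite 1 [← one_smul ℝ (a x, bar (a x))]
      rw [← hpq, add_smul]
      abel
    simp only [U, Set.mem_preimage] at hs ht ⊢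
    rw [this]
    exact convex_ball _ ε hs ht hp hq hpq
  have han : AnalyticOnNhd ℂ (fun t => Ψ (L x t)) U := fun t ht =>
    analyticAt_along (hball _ ht)
  have hz : ∀ᶠ t : ℝ in 𝓝 0, Ψ (L x t) = 0 := by
    have hc : Tendsto (fun t : ℝ => a x + (t : ℂ) • b x) (𝓝 0) (𝓝 (a x)) := by
      have : Continuous (fun t : ℝ => a x + (t : ℂ) • b x) := by fun_prop
      simpa using this.tendsto 0
    filter_upwards [hc.eventually hx2] with t ht
    rw [hreal, ht]
  -- The real zeros accumulate at t = 0, which is enough for the identity theorem to reach t = i.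
  have hfreq : ∃ᶠ t : ℂ in 𝓝[≠] 0, Ψ (L x t) = 0 := by
    have hten : Tendsto (fun t : ℝ => (t : ℂ)) (𝓝[≠] 0) (𝓝[≠] 0) := by
      refine tendsto_nhdsWithin_of_tendsto_nhds_of_eventually_within _ ?_ ?_
      · have := Complex.continuous_ofReal.tendsto 0
        exact (by simpa using this : Tendsto _ (𝓝 (0 : ℝ)) (𝓝 (0 : ℂ))).mono_left
          nhdsWithin_le_nhds
      · filter_upwards [self_mem_nhdsWithin] with t ht
        simpa using ht
    exact hten.frequently (hz.filter_mono nhdsWithin_le_nhds).frequently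
  have := han.eqOn_zero_of_preconnected_of_frequently_eq_zero hU.isPreconnected hx1 hfreq
  have hmem : Complex.I ∈ U := by simpa only [U, Set.mem_preimage, hI] using hx3
  simpa [hI] using this hmem

end Uniqueness

/-! ### Conjugate holomorphic functions -/

section Conjugation

theorem norm_bar (p : ℂ × ℂ) : ‖bar p‖ = ‖p‖ := by
  simp [Prod.norm_def]

/-- The coefficients of the power series of `q ↦ conj (f (q̄))`. -/
def conjSeries (p : FormalMultilinearSeries ℂ (ℂ × ℂ) ℂ) :
    FormalMultilinearSeries ℂ (ℂ × ℂ) ℂ := fun n =>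
  MultilinearMap.mkContinuous
    { toFun := fun m => starRingEnd ℂ (p n fun i => bar (m i))
      map_update_add' := by
        intro _ m i x y
        have h : ∀ z, (fun j => bar (Function.update m i z j)) =
            Function.update (fun j => bar (m j)) i (bar z) := fun z => by
          ext1 j
          rcases eq_or_ne j i with rfl | hj
          · simp
          · simp [hj]
        rw [h, h, h, map_add, ContinuousMultilinearMap.map_update_add, map_add]
      map_update_smul' := by
        intro _ m i c x
        have h : ∀ z, (fun j => bar (Function.update m i z j)) =
            Function.update (fun j => bar (m j)) i (bar z) := fun z => by
          ext1 j
          rcases eq_or_ne j i with rfl | hj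
          · simp
          · simp [hj]
        rw [h, h, bar_smul, ContinuousMultilinearMap.map_update_smul]
        simp }
    ‖p n‖ (fun m => by
      simp only [MultilinearMap.coe_mk, RCLike.norm_conj]
      refine ((p n).le_opNorm _).trans_eq ?_
      simp only [norm_bar])

/-- The holomorphic function `q ↦ conj (f (q̄))`. -/
def conjFun (f : ℂ × ℂ → ℂ) (q : ℂ × ℂ) : ℂ := starRingEnd ℂ (f (bar q))

theorem analyticAt_conjFun {f : ℂ × ℂ → ℂ} (hf : AnalyticAt ℂ f 0) :
    AnalyticAt ℂ (conjFun f) 0 := by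
  obtain ⟨p, r, hp⟩ := hf
  refine ⟨conjSeries p, r, ?_, hp.r_pos, ?_⟩
  · refine hp.r_le.trans (FormalMultilinearSeries.radius_le_of_le fun n => ?_)
    exact MultilinearMap.mkContinuous_norm_le _ (norm_nonneg _) _
  · intro y hy
    have hy' : bar y ∈ Metric.eball (0 : ℂ × ℂ) r := by
      simpa only [Metric.mem_eball, edist_zero_right, ← ofReal_norm, norm_bar] using hy
    have := (hp.hasSum hy').map (starRingEnd ℂ) Complex.continuous_conj
    rw [zero_add] at this ⊢
    exact this

/-- Both sides are values of the real derivative of `conjFun f`, computed once from its holomorphy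
and once by the chain rule through the two conjugations. -/
theorem pd_conjFun_apply (f : ℂ × ℂ → ℂ) {q : ℂ × ℂ} (hf : AnalyticAt ℂ f (bar q))
    (hq : AnalyticAt ℂ (conjFun f) q) (v : ℂ × ℂ) :
    pd v (conjFun f) q = starRingEnd ℂ (pd (bar v) f (bar q)) := by
  have h1 : HasFDerivAt (conjFun f) ((fderiv ℂ (conjFun f) q).restrictScalars ℝ) q :=
    hq.differentiableAt.hasFDerivAt.restrictScalars ℝ
  have h2 : HasFDerivAt (fun x => f (bar x)) (((fderiv ℂ f (bar q)).restrictScalars ℝ).comp bar) q :=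
    (hf.differentiableAt.hasFDerivAt.restrictScalars ℝ).comp q bar.hasFDerivAt
  have h3 := ((Complex.conjCLE : ℂ →L[ℝ] ℂ).hasFDerivAt.comp q h2).unique h1
  exact (congrArg (fun L => L v) h3).symm

theorem pd_conjFun {f : ℂ × ℂ → ℂ} (hf : AnalyticAt ℂ f 0) (v : ℂ × ℂ) :
    pd v (conjFun f) =ᶠ[𝓝 0] conjFun (pd (bar v) f) := by
  have h : ∀ᶠ q in 𝓝 0, AnalyticAt ℂ f (bar q) := by
    have := bar.continuous.tendsto 0
    rw [map_zero] at this
    exact this.eventually hf.eventually_analyticAt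
  filter_upwards [h, (analyticAt_conjFun hf).eventually_analyticAt] with q h1 h2
  exact pd_conjFun_apply f h1 h2 v

theorem conjFun_zero (f : ℂ × ℂ → ℂ) : conjFun f 0 = starRingEnd ℂ (f 0) := by
  rw [conjFun, map_zero]

theorem pX_conjFun {f : ℂ × ℂ → ℂ} (hf : AnalyticAt ℂ f 0) :
    pX (conjFun f) =ᶠ[𝓝 0] conjFun (pX f) := by
  simpa using pd_conjFun hf (1, 0)

theorem pY_conjFun {f : ℂ × ℂ → ℂ} (hf : AnalyticAt ℂ f 0) :
    pY (conjFun f) =ᶠ[𝓝 0] conjFun (pY f) := by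
  simpa using pd_conjFun hf (0, 1)

end Conjugation

/-! ### Holomorphic extension of real-analytic germs -/

section Complexification

/-- The real coordinates of `ℂ²`, extended to linear functionals on `ℂ² × ℂ²`. -/
def realCoord : Fin 4 → (((ℂ × ℂ) × (ℂ × ℂ)) →L[ℂ] ℂ) :=
  let z := (ContinuousLinearMap.fst ℂ ℂ ℂ).comp (ContinuousLinearMap.fst ℂ (ℂ × ℂ) (ℂ × ℂ))
  let ζ := (ContinuousLinearMap.snd ℂ ℂ ℂ).comp (ContinuousLinearMap.fst ℂ (ℂ × ℂ) (ℂ × ℂ))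
  let z' := (ContinuousLinearMap.fst ℂ ℂ ℂ).comp (ContinuousLinearMap.snd ℂ (ℂ × ℂ) (ℂ × ℂ))
  let ζ' := (ContinuousLinearMap.snd ℂ ℂ ℂ).comp (ContinuousLinearMap.snd ℂ (ℂ × ℂ) (ℂ × ℂ))
  ![(1 / 2 : ℂ) • (z + z'), (-Complex.I / 2) • (z - z'),
    (1 / 2 : ℂ) • (ζ + ζ'), (-Complex.I / 2) • (ζ - ζ')]

/-- The standard basis of `ℂ²` over `ℝ`. -/
def realBasis : Fin 4 → ℂ × ℂ := ![(1, 0), (Complex.I, 0), (0, 1), (0, Complex.I)]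

/-- The real coordinates of a point of `ℂ²`. -/
def coordOf (p : ℂ × ℂ) : Fin 4 → ℝ := ![p.1.re, p.1.im, p.2.re, p.2.im]

theorem realCoord_bar (p : ℂ × ℂ) (j : Fin 4) : realCoord j (p, bar p) = coordOf p j := by
  fin_cases j <;> simp [realCoord, coordOf, Complex.ext_iff] <;> ring

theorem sum_coordOf (p : ℂ × ℂ) : ∑ j, coordOf p j • realBasis j = p := by
  simp [Fin.sum_univ_four, coordOf, realBasis]

/-- The complex multilinear extension of a real multilinear map. -/
def complexify {n : ℕ} (p : ContinuousMultilinearMap ℝ (fun _ : Fin n => ℂ × ℂ) ℂ) :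
    ContinuousMultilinearMap ℂ (fun _ : Fin n => (ℂ × ℂ) × (ℂ × ℂ)) ℂ :=
  ∑ i : Fin n → Fin 4, p (fun k => realBasis (i k)) •
    (ContinuousMultilinearMap.mkPiAlgebra ℂ (Fin n) ℂ).compContinuousLinearMap
      (fun k => realCoord (i k))

theorem complexify_diag {n : ℕ} (p : ContinuousMultilinearMap ℝ (fun _ : Fin n => ℂ × ℂ) ℂ)
    (v : ℂ × ℂ) : complexify p (fun _ => (v, bar v)) = p fun _ => v := by
  classical
  conv_rhs => rw [← sum_coordOf v]
  rw [ContinuousMultilinearMap.map_sum]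
  simp only [complexify, sum_apply, smul_apply,
    ContinuousMultilinearMap.compContinuousLinearMap_apply,
    ContinuousMultilinearMap.mkPiAlgebra_apply, realCoord_bar,
    ContinuousMultilinearMap.map_smul_univ]
  refine Finset.sum_congr rfl fun i _ => ?_
  simp [mul_comm]

theorem norm_realBasis (j : Fin 4) : ‖realBasis j‖ = 1 := by
  fin_cases j <;> simp [realBasis, Prod.norm_def]

/-- There are 4ⁿ terms, each at most ‖p‖ times an n-th power. The loss is only geometric in n, so
the complexified series keeps a positive radius of convergence. -/
theorem norm_complexify_le {n : ℕ}
    (p : ContinuousMultilinearMap ℝ (fun _ : Fin n => ℂ × ℂ) ℂ) :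
    ‖complexify p‖ ≤ ‖p‖ * (4 * ∑ j, ‖realCoord j‖) ^ n := by
  have hle : ∀ j, ‖realCoord j‖ ≤ ∑ j, ‖realCoord j‖ := fun j =>
    Finset.single_le_sum (f := fun j => ‖realCoord j‖) (fun _ _ => norm_nonneg _)
      (Finset.mem_univ j)
  refine (norm_sum_le _ _).trans ?_
  have hterm : ∀ i ∈ (Finset.univ : Finset (Fin n → Fin 4)),
      ‖p (fun k => realBasis (i k)) •
        (ContinuousMultilinearMap.mkPiAlgebra ℂ (Fin n) ℂ).compContinuousLinearMap
          (fun k => realCoord (i k))‖ ≤ ‖p‖ * (∑ j, ‖realCoord j‖) ^ n := by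
    intro i _
    rw [norm_smul]
    refine mul_le_mul ?_ ?_ (norm_nonneg _) (norm_nonneg _)
    · refine (p.le_opNorm _).trans_eq ?_
      simp [norm_realBasis]
    · refine (ContinuousMultilinearMap.norm_compContinuousLinearMap_le _ _).trans ?_
      rw [ContinuousMultilinearMap.norm_mkPiAlgebra, one_mul]
      calc ∏ k, ‖realCoord (i k)‖ ≤ ∏ _k : Fin n, ∑ j, ‖realCoord j‖ :=
            Finset.prod_le_prod (fun _ _ => norm_nonneg _) fun k _ => hle _
        _ = _ := by simp
  refine (Finset.sum_le_sum hterm).trans_eq ?_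
  simp [mul_pow]
  ring

theorem exists_complexification {F : ℂ × ℂ → ℂ} (hF : AnalyticAt ℝ F 0) :
    ∃ Φ : (ℂ × ℂ) × (ℂ × ℂ) → ℂ, AnalyticAt ℂ Φ 0 ∧ ∀ᶠ p in 𝓝 0, F p = Φ (p, bar p) := by
  obtain ⟨p, r, hp⟩ := hF
  let q : FormalMultilinearSeries ℂ ((ℂ × ℂ) × (ℂ × ℂ)) ℂ := fun n => complexify (p n)
  let M : ℝ := 4 * ∑ j, ‖realCoord j‖ + 1
  have hM : 0 < M := by positivity
  obtain ⟨s, hs0, hsr⟩ := ENNReal.lt_iff_exists_nnreal_btwn.1 (hp.r_pos.trans_le hp.r_le)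
  obtain ⟨C, hC, hbound⟩ := p.norm_mul_pow_le_of_lt_radius hsr
  have hs : 0 < (s : ℝ) := by exact_mod_cast hs0
  have hq : 0 < q.radius := by
    have hpos : 0 < (s : ℝ) / M := div_pos hs hM
    refine lt_of_lt_of_le ?_
      (q.le_radius_of_bound C (r := ⟨s / M, hpos.le⟩) fun n => ?_)
    · exact ENNReal.coe_pos.2 (NNReal.coe_pos.1 hpos)
    · calc ‖q n‖ * ((s : ℝ) / M) ^ n ≤ (‖p n‖ * M ^ n) * ((s : ℝ) / M) ^ n := by
            gcongr
            refine (norm_complexify_le (p n)).trans ?_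
            gcongr
            simp [M]
        _ = ‖p n‖ * (s : ℝ) ^ n := by
            rw [div_pow]; field_simp
        _ ≤ C := hbound n
  have hΦ := q.hasFPowerSeriesOnBall hq
  refine ⟨q.sum, hΦ.analyticAt, ?_⟩
  have hten : Tendsto (fun v : ℂ × ℂ => (v, bar v)) (𝓝 0) (𝓝 0) := by
    have : Continuous fun v : ℂ × ℂ => (v, bar v) := by fun_prop
    have h := this.tendsto 0
    rwa [map_zero] at h
  filter_upwards [Metric.eball_mem_nhds 0 hp.r_pos,
    hten.eventually (Metric.eball_mem_nhds 0 hq)] with v hv1 hv2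
  have h1 := hp.hasSum hv1
  have h2 := hΦ.hasSum hv2
  have h3 : ∀ n, (q n fun _ => (v, bar v)) = p n fun _ => v := fun n => complexify_diag _ _
  simp only [h3, zero_add] at h1 h2
  exact h1.unique h2

end Complexification

/-! ### Wirtinger derivatives and Taylor coefficients on the complexification -/

/-- The complexification `{(p, q)}` of `ℂ²`, in which `ℂ²` sits as `q = p̄`. -/
abbrev Cx : Type := (ℂ × ℂ) × (ℂ × ℂ)

/-- `∂/∂z` on the complexification. -/
def D1 (Φ : Cx → ℂ) : Cx → ℂ := pd (((1, 0), 0) : Cx) Φ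

/-- `∂/∂ζ` on the complexification. -/
def D2 (Φ : Cx → ℂ) : Cx → ℂ := pd (((0, 1), 0) : Cx) Φ

/-- `∂/∂z̄` on the complexification. -/
def D3 (Φ : Cx → ℂ) : Cx → ℂ := pd ((0, (1, 0)) : Cx) Φ

/-- `∂/∂ζ̄` on the complexification. -/
def D4 (Φ : Cx → ℂ) : Cx → ℂ := pd ((0, (0, 1)) : Cx) Φ

theorem pd_eq_D (Φ : Cx → ℂ) (v w : ℂ × ℂ) (x : Cx) :
    pd (v, w) Φ x = D1 Φ x * v.1 + D2 Φ x * v.2 + D3 Φ x * w.1 + D4 Φ x * w.2 := by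
  have : ((v, w) : Cx) = v.1 • (((1, 0), 0) : Cx) + v.2 • (((0, 1), 0) : Cx)
      + w.1 • ((0, (1, 0)) : Cx) + w.2 • ((0, (0, 1)) : Cx) := by simp
  rw [this, pd_add_dir, pd_add_dir, pd_add_dir, pd_smul, pd_smul, pd_smul, pd_smul]
  simp only [D1, D2, D3, D4]
  ring

/-- `Φ` is a holomorphic extension of the germ `G` to the complexification. -/
structure Extends (Φ : Cx → ℂ) (G : ℂ × ℂ → ℂ) : Prop where
  analytic : AnalyticAt ℂ Φ 0
  eq_bar : ∀ᶠ p in 𝓝 0, G p = Φ (p, bar p)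

theorem tendsto_prod_bar : Tendsto (fun p : ℂ × ℂ => (p, bar p)) (𝓝 0) (𝓝 0) := by
  have : Continuous fun v : ℂ × ℂ => (v, bar v) := by fun_prop
  have h := this.tendsto 0
  rwa [map_zero] at h

theorem tendsto_prod_zero : Tendsto (fun p : ℂ × ℂ => (p, (0 : ℂ × ℂ))) (𝓝 0) (𝓝 0) := by
  have : Continuous fun v : ℂ × ℂ => (v, (0 : ℂ × ℂ)) := by fun_prop
  exact this.tendsto 0

namespace Extends

variable {Φ Φ' : Cx → ℂ} {G : ℂ × ℂ → ℂ}

theorem apply_zero (h : Extends Φ G) : G 0 = Φ 0 := by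
  have := h.eq_bar.self_of_nhds
  rwa [map_zero] at this

/-- A real displacement w moves (p, p̄) by (w, w̄). The Wirtinger combinations of w = 1 and w = i
then isolate one partial derivative of Φ each, which is what the next four lemmas extract. -/
theorem fderiv_real (h : Extends Φ G) :
    ∀ᶠ p in 𝓝 0, ∀ w, fderiv ℝ G p w = pd (w, bar w) Φ (p, bar p) := by
  filter_upwards [h.eq_bar.eventually_nhds,
    tendsto_prod_bar.eventually h.analytic.eventually_analyticAt] with p hp ha w
  have h1 : HasFDerivAt (fun p => Φ (p, bar p)) (((fderiv ℂ Φ (p, bar p)).restrictScalars ℝ).comp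
      ((ContinuousLinearMap.id ℝ (ℂ × ℂ)).prod bar)) p :=
    (ha.differentiableAt.hasFDerivAt.restrictScalars ℝ).comp p
      ((ContinuousLinearMap.id ℝ (ℂ × ℂ)).prod bar).hasFDerivAt
  have h2 : G =ᶠ[𝓝 p] fun p => Φ (p, bar p) := hp
  rw [h2.fderiv_eq, h1.fderiv]
  rfl

theorem dz (h : Extends Φ G) : Extends (D1 Φ) (dz G) := by
  refine ⟨analyticAt_pd h.analytic _, ?_⟩
  filter_upwards [h.fderiv_real] with p hp
  rw [RigidCR.dz, hp, hp, pd_eq_D, pd_eq_D]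
  simp
  linear_combination (D3 Φ (p, (starRingEnd ℂ p.1, starRingEnd ℂ p.2)) / 2
    - D1 Φ (p, (starRingEnd ℂ p.1, starRingEnd ℂ p.2)) / 2) * Complex.I_mul_I

theorem dzeta (h : Extends Φ G) : Extends (D2 Φ) (dzeta G) := by
  refine ⟨analyticAt_pd h.analytic _, ?_⟩
  filter_upwards [h.fderiv_real] with p hp
  rw [RigidCR.dzeta, hp, hp, pd_eq_D, pd_eq_D]
  simp
  linear_combination (D4 Φ (p, (starRingEnd ℂ p.1, starRingEnd ℂ p.2)) / 2
    - D2 Φ (p, (starRingEnd ℂ p.1, starRingEnd ℂ p.2)) / 2) * Complex.I_mul_I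

theorem dzBar (h : Extends Φ G) : Extends (D3 Φ) (dzBar G) := by
  refine ⟨analyticAt_pd h.analytic _, ?_⟩
  filter_upwards [h.fderiv_real] with p hp
  rw [RigidCR.dzBar, hp, hp, pd_eq_D, pd_eq_D]
  simp
  linear_combination (-D3 Φ (p, (starRingEnd ℂ p.1, starRingEnd ℂ p.2)) / 2
    + D1 Φ (p, (starRingEnd ℂ p.1, starRingEnd ℂ p.2)) / 2) * Complex.I_mul_I

theorem dzetaBar (h : Extends Φ G) : Extends (D4 Φ) (dzetaBar G) := by
  refine ⟨analyticAt_pd h.analytic _, ?_⟩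
  filter_upwards [h.fderiv_real] with p hp
  rw [RigidCR.dzetaBar, hp, hp, pd_eq_D, pd_eq_D]
  simp
  linear_combination (-D4 Φ (p, (starRingEnd ℂ p.1, starRingEnd ℂ p.2)) / 2
    + D2 Φ (p, (starRingEnd ℂ p.1, starRingEnd ℂ p.2)) / 2) * Complex.I_mul_I

theorem iterate {D : (Cx → ℂ) → Cx → ℂ} {d : (ℂ × ℂ → ℂ) → ℂ × ℂ → ℂ}
    (hd : ∀ {Φ G}, Extends Φ G → Extends (D Φ) (d G)) (h : Extends Φ G) (n : ℕ) :
    Extends (D^[n] Φ) (d^[n] G) := by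
  induction n with
  | zero => exact h
  | succ n ih =>
    rw [Function.iterate_succ_apply', Function.iterate_succ_apply']
    exact hd ih

theorem mixedDeriv {F : ℂ × ℂ → ℝ} (h : Extends Φ fun p => (F p : ℂ)) (a b c d : ℕ) :
    Extends (D1^[a] (D2^[b] (D3^[c] (D4^[d] Φ)))) (mixedDeriv F a b c d) :=
  ((((h.iterate dzetaBar d).iterate dzBar c).iterate dzeta b).iterate dz a)

end Extends

theorem conj_fderiv (G : ℂ × ℂ → ℂ) (p v : ℂ × ℂ) :
    fderiv ℝ (fun p => starRingEnd ℂ (G p)) p v = starRingEnd ℂ (fderiv ℝ G p v) := by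
  have := Complex.conjCLE.comp_fderiv (f := G) (x := p)
  exact congrArg (fun L => L v) this

theorem conj_dz (G : ℂ × ℂ → ℂ) :
    (fun p => starRingEnd ℂ (dz G p)) = dzBar fun p => starRingEnd ℂ (G p) := by
  ext p
  simp [dz, dzBar, conj_fderiv, (Complex.conj_ofNat 2 : starRingEnd ℂ 2 = 2), sub_eq_add_neg]

theorem conj_dzeta (G : ℂ × ℂ → ℂ) :
    (fun p => starRingEnd ℂ (dzeta G p)) = dzetaBar fun p => starRingEnd ℂ (G p) := by
  ext p
  simp [dzeta, dzetaBar, conj_fderiv, (Complex.conj_ofNat 2 : starRingEnd ℂ 2 = 2), sub_eq_add_neg]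

theorem conj_dzBar (G : ℂ × ℂ → ℂ) :
    (fun p => starRingEnd ℂ (dzBar G p)) = dz fun p => starRingEnd ℂ (G p) := by
  ext p
  simp [dz, dzBar, conj_fderiv, (Complex.conj_ofNat 2 : starRingEnd ℂ 2 = 2), sub_eq_add_neg]

theorem conj_dzetaBar (G : ℂ × ℂ → ℂ) :
    (fun p => starRingEnd ℂ (dzetaBar G p)) = dzeta fun p => starRingEnd ℂ (G p) := by
  ext p
  simp [dzeta, dzetaBar, conj_fderiv, (Complex.conj_ofNat 2 : starRingEnd ℂ 2 = 2), sub_eq_add_neg]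

theorem conj_iterate {d d' : (ℂ × ℂ → ℂ) → ℂ × ℂ → ℂ}
    (h : ∀ G, (fun p => starRingEnd ℂ (d G p)) = d' fun p => starRingEnd ℂ (G p)) (n : ℕ)
    (G : ℂ × ℂ → ℂ) :
    (fun p => starRingEnd ℂ (d^[n] G p)) = d'^[n] fun p => starRingEnd ℂ (G p) := by
  induction n with
  | zero => rfl
  | succ n ih => rw [Function.iterate_succ_apply', Function.iterate_succ_apply', h, ih]

/-- The Taylor coefficients of a real function are Hermitian. -/
theorem coeff_conj {F : ℂ × ℂ → ℝ} {Φ : Cx → ℂ} (h : Extends Φ fun p => (F p : ℂ))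
    (a b c d : ℕ) : coeff F c d a b = starRingEnd ℂ (coeff F a b c d) := by
  -- Conjugation swaps barred and unbarred derivatives and fixes the real function F; what remains
  -- is to reorder commuting derivatives of Φ.
  have h1 : (fun p => starRingEnd ℂ (mixedDeriv F a b c d p)) =
      dzBar^[a] (dzetaBar^[b] (dz^[c] (dzeta^[d] fun p => (F p : ℂ)))) := by
    simp only [mixedDeriv]
    rw [conj_iterate conj_dz, conj_iterate conj_dzeta, conj_iterate conj_dzBar,
      conj_iterate conj_dzetaBar]
    simp
  have h2 := ((((h.iterate Extends.dzeta d).iterate Extends.dz c).iterate Extends.dzetaBar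
    b).iterate Extends.dzBar a).apply_zero
  rw [← h1] at h2
  have hΦ := h.analytic
  rw [show starRingEnd ℂ (coeff F a b c d) = _ from h2, coeff, (h.mixedDeriv c d a b).apply_zero]
  have hD2 := analyticAt_iterate_pd hΦ (((0, 1), 0) : Cx) d
  have hD4 := analyticAt_iterate_pd hΦ ((0, (0, 1)) : Cx) b
  have e1 : D1^[c] (D2^[d] (D3^[a] (D4^[b] Φ))) =ᶠ[𝓝 0] D1^[c] (D3^[a] (D2^[d] (D4^[b] Φ))) :=
    iterate_pd_congr (iterate_pd_comm hD4 _ _ d a) _ c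
  have e2 : D1^[c] (D3^[a] (D2^[d] (D4^[b] Φ))) =ᶠ[𝓝 0] D1^[c] (D3^[a] (D4^[b] (D2^[d] Φ))) :=
    iterate_pd_congr (iterate_pd_congr (iterate_pd_comm hΦ _ _ d b) _ a) _ c
  have e3 : D1^[c] (D3^[a] (D4^[b] (D2^[d] Φ))) =ᶠ[𝓝 0] D3^[a] (D1^[c] (D4^[b] (D2^[d] Φ))) :=
    iterate_pd_comm (analyticAt_iterate_pd hD2 _ b) _ _ c a
  have e4 : D3^[a] (D1^[c] (D4^[b] (D2^[d] Φ))) =ᶠ[𝓝 0] D3^[a] (D4^[b] (D1^[c] (D2^[d] Φ))) :=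
    iterate_pd_congr (iterate_pd_comm hD2 _ _ c b) _ a
  exact (e1.trans (e2.trans (e3.trans e4))).eq_of_nhds

/-- The holomorphic function `∂_z̄^c ∂_ζ̄^d Φ (p, 0)`, a generating function of the Taylor
coefficients `F_{a,b,c,d}`. -/
def jet (Φ : Cx → ℂ) (c d : ℕ) (p : ℂ × ℂ) : ℂ := D3^[c] (D4^[d] Φ) (p, 0)

theorem analyticAt_slice {Φ : Cx → ℂ} (h : AnalyticAt ℂ Φ 0) :
    AnalyticAt ℂ (fun p => Φ (p, 0)) 0 :=
  AnalyticAt.fun_comp (f := ContinuousLinearMap.inl ℂ (ℂ × ℂ) (ℂ × ℂ)) h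
    (ContinuousLinearMap.analyticAt _ _)

theorem pd_slice {Φ : Cx → ℂ} (h : AnalyticAt ℂ Φ 0) (v : ℂ × ℂ) :
    pd v (fun p => Φ (p, 0)) =ᶠ[𝓝 0] fun p => pd ((v, 0) : Cx) Φ (p, 0) := by
  filter_upwards [tendsto_prod_zero.eventually h.eventually_analyticAt] with p hp
  exact pd_comp_clm (L := ContinuousLinearMap.inl ℂ (ℂ × ℂ) (ℂ × ℂ)) hp v

theorem iterate_pd_slice {Φ : Cx → ℂ} (h : AnalyticAt ℂ Φ 0) (v : ℂ × ℂ) (n : ℕ) :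
    (pd v)^[n] (fun p => Φ (p, 0)) =ᶠ[𝓝 0] fun p => (pd ((v, 0) : Cx))^[n] Φ (p, 0) := by
  induction n with
  | zero => rfl
  | succ n ih =>
    simp only [Function.iterate_succ_apply']
    exact (pd_congr ih v).trans (pd_slice (analyticAt_iterate_pd h _ n) v)

theorem analyticAt_D34 {Φ : Cx → ℂ} (h : AnalyticAt ℂ Φ 0) (c d : ℕ) :
    AnalyticAt ℂ (D3^[c] (D4^[d] Φ)) 0 :=
  analyticAt_iterate_pd (analyticAt_iterate_pd h _ d) _ c

theorem analyticAt_jet {Φ : Cx → ℂ} (h : AnalyticAt ℂ Φ 0) (c d : ℕ) :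
    AnalyticAt ℂ (jet Φ c d) 0 := analyticAt_slice (analyticAt_D34 h c d)

theorem pX_pY_jet {Φ : Cx → ℂ} (h : AnalyticAt ℂ Φ 0) (a b c d : ℕ) :
    pX^[a] (pY^[b] (jet Φ c d)) =ᶠ[𝓝 0] fun p => D1^[a] (D2^[b] (D3^[c] (D4^[d] Φ))) (p, 0) :=
  (iterate_pd_congr (iterate_pd_slice (analyticAt_D34 h c d) _ b) _ a).trans
    (iterate_pd_slice (analyticAt_iterate_pd (analyticAt_D34 h c d) _ b) _ a)

theorem coeff_eq_jet {F : ℂ × ℂ → ℝ} {Φ : Cx → ℂ} (h : Extends Φ fun p => (F p : ℂ))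
    (a b c d : ℕ) : coeff F a b c d = pX^[a] (pY^[b] (jet Φ c d)) 0 := by
  rw [(pX_pY_jet h.analytic a b c d).eq_of_nhds]
  exact (h.mixedDeriv a b c d).apply_zero

/-! ### Differentiating the complexified fundamental equation -/

section ChainRuleComplexified

variable {Φ Ψ : Cx → ℂ} {f g s t : ℂ × ℂ → ℂ} {x : Cx}

/-- The product map `(p, q) ↦ ((f p, g p), (s q, t q))`. -/
def prodMap (f g s t : ℂ × ℂ → ℂ) (x : Cx) : Cx := ((f x.1, g x.1), (s x.2, t x.2))

/-- All the data entering a composition `Φ ∘ prodMap f g s t` are analytic at `x`. -/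
structure AnalyticComp (Φ : Cx → ℂ) (f g s t : ℂ × ℂ → ℂ) (x : Cx) : Prop where
  Φ_an : AnalyticAt ℂ Φ (prodMap f g s t x)
  f_an : AnalyticAt ℂ f x.1
  g_an : AnalyticAt ℂ g x.1
  s_an : AnalyticAt ℂ s x.2
  t_an : AnalyticAt ℂ t x.2

namespace AnalyticComp

theorem prodMap_an (h : AnalyticComp Φ f g s t x) : AnalyticAt ℂ (prodMap f g s t) x := by
  have h1 : AnalyticAt ℂ (fun y : Cx => f y.1) x := h.f_an.fun_comp analyticAt_fst
  have h2 : AnalyticAt ℂ (fun y : Cx => g y.1) x := h.g_an.fun_comp analyticAt_fst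
  have h3 : AnalyticAt ℂ (fun y : Cx => s y.2) x := h.s_an.fun_comp analyticAt_snd
  have h4 : AnalyticAt ℂ (fun y : Cx => t y.2) x := h.t_an.fun_comp analyticAt_snd
  exact (h1.prod h2).prod (h3.prod h4)

theorem comp_an (h : AnalyticComp Φ f g s t x) :
    AnalyticAt ℂ (fun y => Φ (prodMap f g s t y)) x := h.Φ_an.fun_comp h.prodMap_an

theorem eventually (h : AnalyticComp Φ f g s t x) :
    ∀ᶠ y in 𝓝 x, AnalyticComp Φ f g s t y := by
  filter_upwards [h.prodMap_an.continuousAt.eventually h.Φ_an.eventually_analyticAt,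
    continuous_fst.continuousAt.eventually h.f_an.eventually_analyticAt,
    continuous_fst.continuousAt.eventually h.g_an.eventually_analyticAt,
    continuous_snd.continuousAt.eventually h.s_an.eventually_analyticAt,
    continuous_snd.continuousAt.eventually h.t_an.eventually_analyticAt] with y h1 h2 h3 h4 h5
  exact ⟨h1, h2, h3, h4, h5⟩

theorem pd (h : AnalyticComp Φ f g s t x) (v : Cx) : AnalyticComp (pd v Φ) f g s t x :=
  ⟨analyticAt_pd h.Φ_an v, h.f_an, h.g_an, h.s_an, h.t_an⟩

theorem pd_comp (h : AnalyticComp Φ f g s t x) (v w : ℂ × ℂ) :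
    RigidCR.pd (v, w) (fun y => Φ (prodMap f g s t y)) x =
      D1 Φ (prodMap f g s t x) * RigidCR.pd v f x.1 + D2 Φ (prodMap f g s t x) * RigidCR.pd v g x.1
        + D3 Φ (prodMap f g s t x) * RigidCR.pd w s x.2
        + D4 Φ (prodMap f g s t x) * RigidCR.pd w t x.2 := by
  have h1 := h.f_an.differentiableAt.hasFDerivAt.comp x (hasFDerivAt_fst (p := x) (𝕜 := ℂ))
  have h2 := h.g_an.differentiableAt.hasFDerivAt.comp x (hasFDerivAt_fst (p := x) (𝕜 := ℂ))
  have h3 := h.s_an.differentiableAt.hasFDerivAt.comp x (hasFDerivAt_snd (p := x) (𝕜 := ℂ))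
  have h4 := h.t_an.differentiableAt.hasFDerivAt.comp x (hasFDerivAt_snd (p := x) (𝕜 := ℂ))
  rw [RigidCR.pd_comp (h := prodMap f g s t) h.Φ_an ((h1.prodMk h2).prodMk (h3.prodMk h4))]
  exact pd_eq_D _ _ _ _

end AnalyticComp

theorem pd_snd (h : AnalyticAt ℂ f x.2) (v w : ℂ × ℂ) :
    pd ((v, w) : Cx) (fun y => f y.2) x = pd w f x.2 :=
  pd_comp_clm (L := ContinuousLinearMap.snd ℂ (ℂ × ℂ) (ℂ × ℂ)) h _

theorem pd_zero {E : Type*} [NormedAddCommGroup E] [NormedSpace ℂ E] (u : E → ℂ) (x : E) :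
    pd 0 u x = 0 := by simp [pd]

/-- `Ψ ∘ prodMap f g s t = ρ Φ` near `x`, all the data being analytic. -/
structure Transforms (Φ Ψ : Cx → ℂ) (f g s t : ℂ × ℂ → ℂ) (ρ : ℂ) (x : Cx) : Prop where
  an : AnalyticComp Ψ f g s t x
  Φ_an : AnalyticAt ℂ Φ x
  eq : ∀ᶠ y in 𝓝 x, Ψ (prodMap f g s t y) = ρ * Φ y

namespace Transforms

variable {ρ : ℂ}

theorem eventually (h : Transforms Φ Ψ f g s t ρ x) :
    ∀ᶠ y in 𝓝 x, Transforms Φ Ψ f g s t ρ y := by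
  filter_upwards [h.an.eventually, h.Φ_an.eventually_analyticAt, h.eq.eventually_nhds] with
    y h1 h2 h3 using ⟨h1, h2, h3⟩

/-- First derivatives in the barred directions. -/
theorem first (h : Transforms Φ Ψ f g s t ρ x) (v : ℂ × ℂ) :
    D3 Ψ (prodMap f g s t x) * pd v s x.2 + D4 Ψ (prodMap f g s t x) * pd v t x.2 =
      ρ * pd ((0, v) : Cx) Φ x := by
  have := pd_congr_at h.eq ((0, v) : Cx)
  rw [h.an.pd_comp, pd_const_mul _ h.Φ_an, pd_zero, pd_zero] at this
  linear_combination this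

/-- One formula serves two purposes: w = 0 gives the transformation of the Levi matrix, and a = 0
gives the second barred derivatives behind `Sends.jet_second`. -/
theorem second (h : Transforms Φ Ψ f g s t ρ x) (a v w : ℂ × ℂ) :
    (D1 (D3 Ψ) (prodMap f g s t x) * pd a f x.1 + D2 (D3 Ψ) (prodMap f g s t x) * pd a g x.1
        + D3 (D3 Ψ) (prodMap f g s t x) * pd w s x.2
        + D3 (D4 Ψ) (prodMap f g s t x) * pd w t x.2) * pd v s x.2
      + D3 Ψ (prodMap f g s t x) * pd w (pd v s) x.2
      + (D1 (D4 Ψ) (prodMap f g s t x) * pd a f x.1 + D2 (D4 Ψ) (prodMap f g s t x) * pd a g x.1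
        + D3 (D4 Ψ) (prodMap f g s t x) * pd w s x.2
        + D4 (D4 Ψ) (prodMap f g s t x) * pd w t x.2) * pd v t x.2
      + D4 Ψ (prodMap f g s t x) * pd w (pd v t) x.2 =
      ρ * pd ((a, w) : Cx) (pd ((0, v) : Cx) Φ) x := by
  have h1 : ∀ᶠ y in 𝓝 x, D3 Ψ (prodMap f g s t y) * pd v s y.2
      + D4 Ψ (prodMap f g s t y) * pd v t y.2 = ρ * pd ((0, v) : Cx) Φ y := by
    filter_upwards [h.eventually] with y hy using hy.first v
  have hs := analyticAt_pd h.an.s_an v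
  have ht := analyticAt_pd h.an.t_an v
  have hs' : AnalyticAt ℂ (fun y : Cx => pd v s y.2) x := hs.fun_comp analyticAt_snd
  have ht' : AnalyticAt ℂ (fun y : Cx => pd v t y.2) x := ht.fun_comp analyticAt_snd
  have h3 : AnalyticComp (D3 Ψ) f g s t x := h.an.pd _
  have h4 : AnalyticComp (D4 Ψ) f g s t x := h.an.pd _
  have := pd_congr_at h1 ((a, w) : Cx)
  rw [pd_const_mul _ (analyticAt_pd h.Φ_an _), pd_add (h3.comp_an.fun_mul hs')
    (h4.comp_an.fun_mul ht'), pd_mul h3.comp_an hs', pd_mul h4.comp_an ht', h3.pd_comp, h4.pd_comp,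
    pd_snd hs, pd_snd ht] at this
  have hc : D4 (D3 Ψ) (prodMap f g s t x) = D3 (D4 Ψ) (prodMap f g s t x) :=
    pd_comm_at h.an.Φ_an _ _
  rw [hc] at this
  linear_combination this

end Transforms

end ChainRuleComplexified

/-! ### The Levi determinant -/

/-- The Levi determinant on the complexification. -/
def leviDet (Φ : Cx → ℂ) (x : Cx) : ℂ :=
  D1 (D3 Φ) x * D2 (D4 Φ) x - D1 (D4 Φ) x * D2 (D3 Φ) x

theorem analyticAt_leviDet {Φ : Cx → ℂ} (h : AnalyticAt ℂ Φ 0) : AnalyticAt ℂ (leviDet Φ) 0 :=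
  ((analyticAt_pd (analyticAt_pd h _) _).fun_mul (analyticAt_pd (analyticAt_pd h _) _)).fun_sub
    ((analyticAt_pd (analyticAt_pd h _) _).fun_mul (analyticAt_pd (analyticAt_pd h _) _))

/-- The Jacobian determinant of `(f, g)`. -/
def jac (f g : ℂ × ℂ → ℂ) (p : ℂ × ℂ) : ℂ := pX f p * pY g p - pY f p * pX g p

/-- The mixed second derivatives transform by the Jacobian matrices of (f, g) and (s, t) on the two
sides, since f, g depend on p alone and s, t on q alone. Vanishing of the Levi determinant is
therefore invariant. -/
theorem Transforms.leviDet_eq {Φ Ψ : Cx → ℂ} {f g s t : ℂ × ℂ → ℂ} {x : Cx} {ρ : ℂ}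
    (h : Transforms Φ Ψ f g s t ρ x) :
    leviDet Ψ (prodMap f g s t x) * (jac f g x.1 * jac s t x.2) = ρ ^ 2 * leviDet Φ x := by
  have h11 := h.second (1, 0) (1, 0) 0
  have h12 := h.second (1, 0) (0, 1) 0
  have h21 := h.second (0, 1) (1, 0) 0
  have h22 := h.second (0, 1) (0, 1) 0
  simp only [pd_zero, mul_zero, add_zero] at h11 h12 h21 h22
  have e : ρ ^ 2 * leviDet Φ x = (ρ * D1 (D3 Φ) x) * (ρ * D2 (D4 Φ) x)
    - (ρ * D1 (D4 Φ) x) * (ρ * D2 (D3 Φ) x) := by simp only [leviDet]; ring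
  rw [e]
  simp only [D1, D2, D3, D4] at h11 h12 h21 h22 ⊢
  rw [← h11, ← h12, ← h21, ← h22]
  simp only [leviDet, jac, D1, D2, D3, D4]
  ring

/-- `F` is the graphing function, with complexification `Φ`, of a rigid hypersurface without
harmonic monomials whose Levi determinant vanishes. -/
structure IsGraph (F : ℂ × ℂ → ℝ) (Φ : Cx → ℂ) : Prop where
  ext : Extends Φ fun p => (F p : ℂ)
  real_analytic : AnalyticAt ℝ F 0
  harmonic : ∀ᶠ p in 𝓝 (0 : ℂ × ℂ), Φ (p, 0) = 0
  levi : ∀ᶠ x in 𝓝 0, leviDet Φ x = 0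

theorem analyticAt_ofReal_comp {F : ℂ × ℂ → ℝ} (h : AnalyticAt ℝ F 0) :
    AnalyticAt ℝ (fun p => (F p : ℂ)) 0 :=
  (Complex.ofRealCLM.analyticAt _).fun_comp h

theorem extends_leviDet {F : ℂ × ℂ → ℝ} {Φ : Cx → ℂ} (h : Extends Φ fun p => (F p : ℂ)) :
    ∀ᶠ p in 𝓝 0, (leviMatrix F p).det = leviDet Φ (p, bar p) := by
  filter_upwards [(h.mixedDeriv 1 0 1 0).eq_bar, (h.mixedDeriv 0 1 0 1).eq_bar,
    (h.mixedDeriv 1 0 0 1).eq_bar, (h.mixedDeriv 0 1 1 0).eq_bar] with p h1 h2 h3 h4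
  rw [leviMatrix, Matrix.det_fin_two_of, h1, h2, h3, h4]
  rfl

theorem det_eq_zero_of_rank_eq_one {M : Matrix (Fin 2) (Fin 2) ℂ} (h : M.rank = 1) :
    M.det = 0 := by
  by_contra hM
  have := Matrix.rank_of_isUnit M ((Matrix.isUnit_iff_isUnit_det M).2 (isUnit_iff_ne_zero.2 hM))
  simp [h] at this

theorem rank_eq_one_of_det_eq_zero {M : Matrix (Fin 2) (Fin 2) ℂ} (h : M.det = 0)
    (h0 : M 0 0 ≠ 0) : M.rank = 1 := by
  have hle : M.rank ≤ 1 := by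
    -- With zero determinant and nonzero corner, the second row is the multiple M₁₀/M₀₀ of the
    -- first.
    have hM : M = Matrix.vecMulVec ![1, M 1 0 / M 0 0] ![M 0 0, M 0 1] := by
      rw [Matrix.det_fin_two] at h
      ext i j
      fin_cases i <;> fin_cases j <;> simp [Matrix.vecMulVec, h0]
      field_simp
      linear_combination h
    rw [hM]
    exact Matrix.rank_vecMulVec_le _ _
  have hpos : M.rank ≠ 0 := fun h2 => h0 (by
    have hbot : M.mulVecLin = 0 := LinearMap.range_eq_bot.1 (Submodule.finrank_eq_zero.1 h2)
    have := congrFun (congrArg (fun L => L (Pi.single 0 1)) hbot) 0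
    simpa using this)
  omega

theorem MemH.exists_isGraph {F : ℂ × ℂ → ℝ} (h : MemH F) : ∃ Φ, IsGraph F Φ := by
  obtain ⟨Φ, hΦ, hF⟩ := exists_complexification (analyticAt_ofReal_comp h.analytic)
  have hext : Extends Φ fun p => (F p : ℂ) := ⟨hΦ, hF⟩
  refine ⟨Φ, hext, h.analytic, ?_, ?_⟩
  · refine eventually_eq_zero_of_iterate_pd (analyticAt_slice hΦ) fun a b => ?_
    have := h.no_harmonic a b
    rwa [coeff_eq_jet hext] at this
  · refine eventually_eq_zero_of_bar (analyticAt_leviDet hΦ) ?_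
    filter_upwards [extends_leviDet hext, h.levi_rank_one] with p h1 h2
    rw [← h1]
    exact det_eq_zero_of_rank_eq_one h2

/-! ### Action of rigid transformations on graphs -/

namespace RigidTransformation

variable (T : RigidTransformation)

/-- The map `(f, g)` of `ℂ²`. -/
def map (p : ℂ × ℂ) : ℂ × ℂ := (T.f p, T.g p)

theorem map_zero' : T.map 0 = 0 := by simp [map, T.f_zero, T.g_zero]

theorem jac_ne_zero : jac T.f T.g 0 ≠ 0 := by
  have := ((Matrix.isUnit_iff_isUnit_det _).1 T.jacobian).ne_zero
  rwa [Matrix.det_fin_two_of] at this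

theorem analyticAt_map : AnalyticAt ℂ T.map 0 := T.f_analytic.prod T.g_analytic

theorem exists_equiv : ∃ L : (ℂ × ℂ) ≃L[ℂ] (ℂ × ℂ),
    HasStrictFDerivAt T.map (L : (ℂ × ℂ) →L[ℂ] (ℂ × ℂ)) 0 := by
  let L : (ℂ × ℂ) →L[ℂ] (ℂ × ℂ) := (fderiv ℂ T.f 0).prod (fderiv ℂ T.g 0)
  have hL : Function.Injective (L : (ℂ × ℂ) →ₗ[ℂ] (ℂ × ℂ)) := by
    rw [← LinearMap.ker_eq_bot, LinearMap.ker_eq_bot']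
    rintro ⟨a, b⟩ h
    have h1 : pd (a, b) T.f 0 = 0 := congrArg Prod.fst h
    have h2 : pd (a, b) T.g 0 = 0 := congrArg Prod.snd h
    rw [pd_pair] at h1 h2
    have hj := T.jac_ne_zero
    rw [jac] at hj
    have ha : (pX T.f 0 * pY T.g 0 - pY T.f 0 * pX T.g 0) * a = 0 := by
      linear_combination pY T.g 0 * h1 - pY T.f 0 * h2
    have hb : (pX T.f 0 * pY T.g 0 - pY T.f 0 * pX T.g 0) * b = 0 := by
      linear_combination pX T.f 0 * h2 - pX T.g 0 * h1
    ext
    · exact (mul_eq_zero.1 ha).resolve_left hj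
    · exact (mul_eq_zero.1 hb).resolve_left hj
  refine ⟨(LinearEquiv.ofInjectiveEndo _ hL).toContinuousLinearEquiv, ?_⟩
  exact T.f_analytic.hasStrictFDerivAt.prodMk T.g_analytic.hasStrictFDerivAt

theorem map_nhds : Filter.map T.map (𝓝 0) = 𝓝 0 := by
  obtain ⟨L, hL⟩ := T.exists_equiv
  rw [hL.map_nhds_eq_of_equiv, T.map_zero']

theorem eventually_map {P : ℂ × ℂ → Prop} : (∀ᶠ p in 𝓝 0, P (T.map p)) ↔ ∀ᶠ p in 𝓝 0, P p := by
  rw [← Filter.eventually_map (m := T.map) (P := P), T.map_nhds]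

theorem exists_inverse : ∃ S : ℂ × ℂ → ℂ × ℂ, AnalyticAt ℂ S 0 ∧ S 0 = 0 ∧
    ∀ᶠ p in 𝓝 0, S (T.map p) = p := by
  obtain ⟨L, hL⟩ := T.exists_equiv
  have hc : ContDiffAt ℂ ⊤ T.map 0 := T.analyticAt_map.contDiffAt
  refine ⟨hc.localInverse hL.hasFDerivAt (by simp), ?_, ?_, ?_⟩
  · have := hc.to_localInverse hL.hasFDerivAt (by simp)
    rw [T.map_zero'] at this
    exact this.analyticAt
  · have := hc.localInverse_apply_image hL.hasFDerivAt (by simp)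
    rwa [T.map_zero'] at this
  · exact (hc.hasStrictFDerivAt' hL.hasFDerivAt (by simp)).eventually_left_inverse

/-- The equation on real points extends off q = p̄ by `eventually_eq_zero_of_bar`; the barred
components are replaced by the independent holomorphic functions `conjFun T.f` and `conjFun T.g`. -/
theorem transforms {F G : ℂ × ℂ → ℝ} {Φ Ψ : Cx → ℂ} (hΦ : Extends Φ fun p => (F p : ℂ))
    (hΨ : Extends Ψ fun p => (G p : ℂ)) (h : T.Sends F G) :
    Transforms Φ Ψ T.f T.g (conjFun T.f) (conjFun T.g) T.ρ 0 := by
  have hf := analyticAt_conjFun T.f_analytic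
  have hg := analyticAt_conjFun T.g_analytic
  have h0 : prodMap T.f T.g (conjFun T.f) (conjFun T.g) 0 = 0 := by
    simp [prodMap, T.f_zero, T.g_zero, conjFun_zero]
  have han : AnalyticComp Ψ T.f T.g (conjFun T.f) (conjFun T.g) 0 :=
    ⟨by rw [h0]; exact hΨ.analytic, T.f_analytic, T.g_analytic, hf, hg⟩
  refine ⟨han, hΦ.analytic, ?_⟩
  have := eventually_eq_zero_of_bar
    (han.comp_an.fun_sub ((analyticAt_const (v := (T.ρ : ℂ))).fun_mul hΦ.analytic)) (by
    filter_upwards [hΦ.eq_bar, T.eventually_map.2 hΨ.eq_bar, h] with p h1 h2 h3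
    have h4 : prodMap T.f T.g (conjFun T.f) (conjFun T.g) (p, bar p) =
        (T.map p, bar (T.map p)) := by
      simp only [prodMap, conjFun, bar_bar]
      rfl
    rw [h4, ← h2, ← h1, map, h3]
    push_cast
    ring)
  filter_upwards [this] with x hx using sub_eq_zero.1 hx

/-- Any transformation defines its own target, ρF composed with the local inverse. Each
normalization step thus only has to choose f, g, ρ and read off the jets of the image. -/
theorem exists_sends {F : ℂ × ℂ → ℝ} {Φ : Cx → ℂ} (h : IsGraph F Φ) :
    ∃ G Ψ, IsGraph G Ψ ∧ T.Sends F G := by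
  obtain ⟨S, hS, hS0, hST⟩ := T.exists_inverse
  let G : ℂ × ℂ → ℝ := fun q => T.ρ * F (S q)
  have hG : AnalyticAt ℝ G 0 := by
    have h1 : AnalyticAt ℝ F (S 0) := by rw [hS0]; exact h.real_analytic
    exact analyticAt_const.fun_mul (h1.fun_comp (hS.restrictScalars (𝕜 := ℝ)))
  have hsend : T.Sends F G := by
    filter_upwards [hST] with p hp
    change T.ρ * F (S (T.map p)) = _
    rw [hp]
  obtain ⟨Ψ, hΨ, hGΨ⟩ := exists_complexification (analyticAt_ofReal_comp hG)
  have hext : Extends Ψ fun p => (G p : ℂ) := ⟨hΨ, hGΨ⟩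
  have htr := T.transforms h.ext hext hsend
  refine ⟨G, Ψ, ⟨hext, hG, ?_, ?_⟩, hsend⟩
  -- Since the conjugate components vanish at 0, the slice q = 0 is mapped to itself, so harmonic
  -- monomials stay absent.
  · rw [← T.eventually_map]
    filter_upwards [tendsto_prod_zero.eventually htr.eq, h.harmonic] with p h1 h2
    rw [h2, mul_zero] at h1
    rw [← h1]
    simp [prodMap, conjFun_zero, T.f_zero, T.g_zero, map]
    rfl
  · refine eventually_eq_zero_of_bar (analyticAt_leviDet hΨ) ?_
    rw [← T.eventually_map]
    have hj : ∀ᶠ p in 𝓝 0, jac T.f T.g p ≠ 0 := by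
      have : ContinuousAt (jac T.f T.g) 0 :=
        (((analyticAt_pd T.f_analytic _).fun_mul (analyticAt_pd T.g_analytic _)).fun_sub
          ((analyticAt_pd T.f_analytic _).fun_mul (analyticAt_pd T.g_analytic _))).continuousAt
      exact this.eventually_ne T.jac_ne_zero
    have hj' : ∀ᶠ p in 𝓝 0, jac (conjFun T.f) (conjFun T.g) p ≠ 0 := by
      have hf := analyticAt_conjFun T.f_analytic
      have hg := analyticAt_conjFun T.g_analytic
      have : ContinuousAt (jac (conjFun T.f) (conjFun T.g)) 0 :=
        (((analyticAt_pd hf _).fun_mul (analyticAt_pd hg _)).fun_sub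
          ((analyticAt_pd hf _).fun_mul (analyticAt_pd hg _))).continuousAt
      refine this.eventually_ne ?_
      rw [jac, (pX_conjFun T.f_analytic).eq_of_nhds, (pY_conjFun T.f_analytic).eq_of_nhds,
        (pX_conjFun T.g_analytic).eq_of_nhds, (pY_conjFun T.g_analytic).eq_of_nhds,
        conjFun_zero, conjFun_zero, conjFun_zero, conjFun_zero, ← map_mul, ← map_mul, ← map_sub]
      exact (_root_.map_ne_zero _).2 T.jac_ne_zero
    have hbar : Tendsto bar (𝓝 0) (𝓝 0) := by
      have := bar.continuous.tendsto 0
      rwa [_root_.map_zero] at this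
    filter_upwards [tendsto_prod_bar.eventually htr.eventually, hj, hbar.eventually hj',
      tendsto_prod_bar.eventually h.levi] with p h1 h2 h3 h4
    have h5 := h1.leviDet_eq
    rw [h4, mul_zero] at h5
    have h6 : prodMap T.f T.g (conjFun T.f) (conjFun T.g) (p, bar p) =
        (T.map p, bar (T.map p)) := by
      simp only [prodMap, conjFun, bar_bar]
      rfl
    rw [h6] at h5
    exact (mul_eq_zero.1 h5).resolve_right (mul_ne_zero h2 h3)

/-- Composition of rigid transformations. -/
theorem Sends.exists_comp {T S : RigidTransformation} {F G K : ℂ × ℂ → ℝ} (h : T.Sends F G)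
    (h' : S.Sends G K) : ∃ R : RigidTransformation, R.Sends F K ∧
      R.f = (fun p => S.f (T.map p)) ∧ R.g = (fun p => S.g (T.map p)) ∧ R.ρ = S.ρ * T.ρ := by
  have hSf : AnalyticAt ℂ S.f (T.f 0, T.g 0) := by
    rw [T.f_zero, T.g_zero]; exact S.f_analytic
  have hSg : AnalyticAt ℂ S.g (T.f 0, T.g 0) := by
    rw [T.f_zero, T.g_zero]; exact S.g_analytic
  refine ⟨⟨fun p => S.f (T.map p), fun p => S.g (T.map p), S.ρ * T.ρ,
    analyticAt_comp_pair hSf T.f_analytic T.g_analytic,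
    analyticAt_comp_pair hSg T.f_analytic T.g_analytic, by simp [map_zero', S.f_zero],
    by simp [map_zero', S.g_zero], ?_, mul_ne_zero S.ρ_ne_zero T.ρ_ne_zero⟩, ?_, rfl, rfl, rfl⟩
  · rw [Matrix.isUnit_iff_isUnit_det, Matrix.det_fin_two_of, isUnit_iff_ne_zero]
    have e1 := fun v => pd_comp_pair hSf T.f_analytic T.g_analytic v
    have e2 := fun v => pd_comp_pair hSg T.f_analytic T.g_analytic v
    change pX (fun p => S.f (T.f p, T.g p)) 0 * pY (fun p => S.g (T.f p, T.g p)) 0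
      - pY (fun p => S.f (T.f p, T.g p)) 0 * pX (fun p => S.g (T.f p, T.g p)) 0 ≠ 0
    rw [pX, pY, pX, pY, e1, e1, e2, e2, T.f_zero, T.g_zero]
    have := mul_ne_zero S.jac_ne_zero T.jac_ne_zero
    convert this using 1
    simp only [jac, Prod.mk_zero_zero]
    ring
  · filter_upwards [h, T.eventually_map.2 h'] with p h1 h2
    rw [h2, map, h1]
    ring

end RigidTransformation

/-- Constructor for rigid transformations. -/
theorem exists_rigidTransformation {f g : ℂ × ℂ → ℂ} {ρ : ℝ} (hf : AnalyticAt ℂ f 0)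
    (hg : AnalyticAt ℂ g 0) (hf0 : f 0 = 0) (hg0 : g 0 = 0) (hj : jac f g 0 ≠ 0) (hρ : ρ ≠ 0) :
    ∃ T : RigidTransformation, T.f = f ∧ T.g = g ∧ T.ρ = ρ :=
  ⟨⟨f, g, ρ, hf, hg, hf0, hg0, by
    rw [Matrix.isUnit_iff_isUnit_det, Matrix.det_fin_two_of, isUnit_iff_ne_zero]
    exact hj, hρ⟩, rfl, rfl, rfl⟩

/-! ### Transformation law of the jets -/

namespace RigidTransformation

variable {T : RigidTransformation} {F G : ℂ × ℂ → ℝ} {Φ Ψ : Cx → ℂ}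

theorem prodMap_conj_zero (T : RigidTransformation) (p : ℂ × ℂ) :
    prodMap T.f T.g (conjFun T.f) (conjFun T.g) (p, 0) = (T.map p, 0) := by
  simp only [prodMap, conjFun_zero, T.f_zero, T.g_zero, _root_.map_zero]
  rfl

theorem Sends.jet_first (hs : T.Sends F G) (hΦ : Extends Φ fun p => (F p : ℂ))
    (hΨ : Extends Ψ fun p => (G p : ℂ)) :
    ∀ᶠ p in 𝓝 0,
      jet Ψ 1 0 (T.map p) * starRingEnd ℂ (pX T.f 0)
        + jet Ψ 0 1 (T.map p) * starRingEnd ℂ (pX T.g 0) = T.ρ * jet Φ 1 0 p ∧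
      jet Ψ 1 0 (T.map p) * starRingEnd ℂ (pY T.f 0)
        + jet Ψ 0 1 (T.map p) * starRingEnd ℂ (pY T.g 0) = T.ρ * jet Φ 0 1 p := by
  filter_upwards [tendsto_prod_zero.eventually (T.transforms hΦ hΨ hs).eventually] with p hp
  have h1 := hp.first (1, 0)
  have h2 := hp.first (0, 1)
  rw [T.prodMap_conj_zero] at h1 h2
  have e1 := (pX_conjFun T.f_analytic).eq_of_nhds
  have e2 := (pX_conjFun T.g_analytic).eq_of_nhds
  have e3 := (pY_conjFun T.f_analytic).eq_of_nhds
  have e4 := (pY_conjFun T.g_analytic).eq_of_nhds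
  rw [conjFun_zero] at e1 e2 e3 e4
  rw [← e1, ← e2, ← e3, ← e4]
  exact ⟨h1, h2⟩

/-- The condition g_z(0) = 0 removes the terms in ∂_ζ̄² Ψ, and the ∂_z̄∂_ζ̄ Ψ term from the first
relation. All uses are arranged to satisfy it. -/
theorem Sends.jet_second (hs : T.Sends F G) (hΦ : Extends Φ fun p => (F p : ℂ))
    (hΨ : Extends Ψ fun p => (G p : ℂ)) (hg : pX T.g 0 = 0) :
    ∀ᶠ p in 𝓝 0,
      jet Ψ 2 0 (T.map p) * starRingEnd ℂ (pX T.f 0) ^ 2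
        + jet Ψ 1 0 (T.map p) * starRingEnd ℂ (pX (pX T.f) 0)
        + jet Ψ 0 1 (T.map p) * starRingEnd ℂ (pX (pX T.g) 0) = T.ρ * jet Φ 2 0 p ∧
      jet Ψ 2 0 (T.map p) * starRingEnd ℂ (pX T.f 0 * pY T.f 0)
        + jet Ψ 1 1 (T.map p) * starRingEnd ℂ (pX T.f 0 * pY T.g 0)
        + jet Ψ 1 0 (T.map p) * starRingEnd ℂ (pX (pY T.f) 0)
        + jet Ψ 0 1 (T.map p) * starRingEnd ℂ (pX (pY T.g) 0) = T.ρ * jet Φ 1 1 p := by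
  filter_upwards [tendsto_prod_zero.eventually (T.transforms hΦ hΨ hs).eventually] with p hp
  have h1 := hp.second 0 (1, 0) (1, 0)
  have h2 := hp.second 0 (0, 1) (1, 0)
  rw [T.prodMap_conj_zero] at h1 h2
  have hf := T.f_analytic
  have hg' := T.g_analytic
  have e1 : pX (conjFun T.f) 0 = _ := (pX_conjFun hf).eq_of_nhds.trans (conjFun_zero _)
  have e2 : pX (conjFun T.g) 0 = _ := (pX_conjFun hg').eq_of_nhds.trans (conjFun_zero _)
  have e3 : pY (conjFun T.f) 0 = _ := (pY_conjFun hf).eq_of_nhds.trans (conjFun_zero _)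
  have e4 : pY (conjFun T.g) 0 = _ := (pY_conjFun hg').eq_of_nhds.trans (conjFun_zero _)
  have e5 : pX (pX (conjFun T.f)) 0 = _ := (pd_congr_at (pX_conjFun hf) _).trans
    ((pX_conjFun (analyticAt_pd hf _)).eq_of_nhds.trans (conjFun_zero _))
  have e6 : pX (pX (conjFun T.g)) 0 = _ := (pd_congr_at (pX_conjFun hg') _).trans
    ((pX_conjFun (analyticAt_pd hg' _)).eq_of_nhds.trans (conjFun_zero _))
  have e7 : pX (pY (conjFun T.f)) 0 = _ := (pd_congr_at (pY_conjFun hf) _).trans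
    ((pX_conjFun (analyticAt_pd hf _)).eq_of_nhds.trans (conjFun_zero _))
  have e8 : pX (pY (conjFun T.g)) 0 = _ := (pd_congr_at (pY_conjFun hg') _).trans
    ((pX_conjFun (analyticAt_pd hg' _)).eq_of_nhds.trans (conjFun_zero _))
  simp only [pd_zero, mul_zero, zero_add, e1, e2, e3, e4, e5, e6, e7, e8, hg, _root_.map_zero,
    add_zero] at h1 h2
  simp only [_root_.map_mul]
  refine ⟨?_, ?_⟩
  · refine Eq.trans ?_ h1
    simp only [jet, Function.iterate_succ, Function.iterate_zero, Function.comp, id]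
    ring
  · refine Eq.trans ?_ h2
    simp only [jet, Function.iterate_succ, Function.iterate_zero, Function.comp, id]
    ring

end RigidTransformation

/-! ### Relations between jets from Hermitian symmetry and the Levi equation -/

section JetRelations

variable {F : ℂ × ℂ → ℝ} {Φ : Cx → ℂ}

theorem Extends.jet_conj (h : Extends Φ fun p => (F p : ℂ)) (a b c d : ℕ) :
    pX^[a] (pY^[b] (jet Φ c d)) 0 = starRingEnd ℂ (pX^[c] (pY^[d] (jet Φ a b)) 0) := by
  rw [← coeff_eq_jet h, ← coeff_eq_jet h, coeff_conj h]

theorem IsGraph.jet_zero_zero (h : IsGraph F Φ) : jet Φ 0 0 =ᶠ[𝓝 0] fun _ => 0 := h.harmonic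

theorem iterate_pd_zero (v : ℂ × ℂ) (n : ℕ) :
    (pd v)^[n] (fun _ : ℂ × ℂ => (0 : ℂ)) = fun _ => 0 := by
  induction n with
  | zero => rfl
  | succ n ih =>
    rw [Function.iterate_succ_apply', ih]
    ext p
    exact pd_const 0 v p

theorem IsGraph.coeff_harmonic (h : IsGraph F Φ) (a b : ℕ) :
    pX^[a] (pY^[b] (jet Φ 0 0)) 0 = 0 := by
  rw [(iterate_pd_congr (iterate_pd_congr h.jet_zero_zero _ b) _ a).eq_of_nhds,
    iterate_pd_zero, iterate_pd_zero]

theorem IsGraph.jet_apply_zero (h : IsGraph F Φ) (c d : ℕ) : jet Φ c d 0 = 0 := by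
  have := h.ext.jet_conj 0 0 c d
  rwa [h.coeff_harmonic, map_zero] at this

theorem IsGraph.levi_jet (h : IsGraph F Φ) :
    ∀ᶠ p in 𝓝 0, pX (jet Φ 1 0) p * pY (jet Φ 0 1) p
      - pX (jet Φ 0 1) p * pY (jet Φ 1 0) p = 0 := by
  have hΦ := h.ext.analytic
  filter_upwards [tendsto_prod_zero.eventually h.levi, pX_pY_jet hΦ 1 0 1 0, pX_pY_jet hΦ 0 1 0 1,
    pX_pY_jet hΦ 1 0 0 1, pX_pY_jet hΦ 0 1 1 0] with p h0 h1 h2 h3 h4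
  simp only [Function.iterate_succ, Function.iterate_zero, Function.comp, id] at h1 h2 h3 h4
  rw [h1, h2, h3, h4]
  exact h0

/-- This is the z̄-derivative of the Levi equation restricted to q = 0; a z̄-derivative turns A into
C and D into E. -/
theorem IsGraph.levi_jet_deriv (h : IsGraph F Φ) :
    ∀ᶠ p in 𝓝 0, pX (jet Φ 2 0) p * pY (jet Φ 0 1) p + pX (jet Φ 1 0) p * pY (jet Φ 1 1) p
      - pX (jet Φ 1 1) p * pY (jet Φ 1 0) p - pX (jet Φ 0 1) p * pY (jet Φ 2 0) p = 0 := by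
  have hΦ := h.ext.analytic
  filter_upwards [tendsto_prod_zero.eventually h.levi.eventually_nhds,
    tendsto_prod_zero.eventually hΦ.eventually_analyticAt,
    pX_pY_jet hΦ 1 0 1 0, pX_pY_jet hΦ 0 1 0 1, pX_pY_jet hΦ 1 0 0 1, pX_pY_jet hΦ 0 1 1 0,
    pX_pY_jet hΦ 1 0 2 0, pX_pY_jet hΦ 0 1 2 0, pX_pY_jet hΦ 1 0 1 1, pX_pY_jet hΦ 0 1 1 1] with
    p h0 ha h1 h2 h3 h4 h5 h6 h7 h8
  simp only [Function.iterate_succ, Function.iterate_zero, Function.comp, id] at h1 h2 h3 h4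
  simp only [Function.iterate_succ, Function.iterate_zero, Function.comp, id] at h5 h6 h7 h8
  rw [h1, h2, h3, h4, h5, h6, h7, h8]
  have h3' : AnalyticAt ℂ (D3 Φ) (p, 0) := analyticAt_pd ha _
  have h4' : AnalyticAt ℂ (D4 Φ) (p, 0) := analyticAt_pd ha _
  have h13 : AnalyticAt ℂ (D1 (D3 Φ)) (p, 0) := analyticAt_pd h3' _
  have h24 : AnalyticAt ℂ (D2 (D4 Φ)) (p, 0) := analyticAt_pd h4' _
  have h14 : AnalyticAt ℂ (D1 (D4 Φ)) (p, 0) := analyticAt_pd h4' _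
  have h23 : AnalyticAt ℂ (D2 (D3 Φ)) (p, 0) := analyticAt_pd h3' _
  have h9 : pd ((0, (1, 0)) : Cx) (fun x => D1 (D3 Φ) x * D2 (D4 Φ) x - D1 (D4 Φ) x * D2 (D3 Φ) x)
      (p, 0) = pd ((0, (1, 0)) : Cx) (fun _ => 0) (p, 0) := pd_congr_at h0 _
  rw [pd_const, pd_sub (h13.fun_mul h24) (h14.fun_mul h23), pd_mul h13 h24, pd_mul h14 h23] at h9
  have c1 : pd ((0, (1, 0)) : Cx) (D1 (D3 Φ)) (p, 0) = D1 (D3 (D3 Φ)) (p, 0) :=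
    pd_comm_at h3' _ _
  have c2 : pd ((0, (1, 0)) : Cx) (D2 (D4 Φ)) (p, 0) = D2 (D3 (D4 Φ)) (p, 0) :=
    pd_comm_at h4' _ _
  have c3 : pd ((0, (1, 0)) : Cx) (D1 (D4 Φ)) (p, 0) = D1 (D3 (D4 Φ)) (p, 0) :=
    pd_comm_at h4' _ _
  have c4 : pd ((0, (1, 0)) : Cx) (D2 (D3 Φ)) (p, 0) = D2 (D3 (D3 Φ)) (p, 0) :=
    pd_comm_at h3' _ _
  rw [c1, c2, c3, c4] at h9
  linear_combination h9

/-- The first normalization: `∂_z̄ Φ(z, ζ, 0, 0) = z`. -/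
structure IsGraph1 (F : ℂ × ℂ → ℝ) (Φ : Cx → ℂ) : Prop extends IsGraph F Φ where
  jet_one : jet Φ 1 0 =ᶠ[𝓝 0] fun p => p.1

theorem pX_congr_fst {u : ℂ × ℂ → ℂ} (h : u =ᶠ[𝓝 0] fun p => p.1) :
    pX u =ᶠ[𝓝 0] fun _ => 1 := by
  filter_upwards [pd_congr h (1, 0)] with p hp using hp.trans (pX_fst p)

theorem pY_congr_fst {u : ℂ × ℂ → ℂ} (h : u =ᶠ[𝓝 0] fun p => p.1) :
    pY u =ᶠ[𝓝 0] fun _ => 0 := by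
  filter_upwards [pd_congr h (0, 1)] with p hp using hp.trans (pY_fst p)

theorem pY_congr_snd {u : ℂ × ℂ → ℂ} (h : u =ᶠ[𝓝 0] fun p => p.2) :
    pY u =ᶠ[𝓝 0] fun _ => 1 := by
  filter_upwards [pd_congr h (0, 1)] with p hp using hp.trans (pY_snd p)

theorem pd_congr_const {u : ℂ × ℂ → ℂ} {c : ℂ} (h : u =ᶠ[𝓝 0] fun _ => c) (v : ℂ × ℂ) :
    pd v u =ᶠ[𝓝 0] fun _ => 0 := by
  filter_upwards [pd_congr h v] with p hp using hp.trans (pd_const c v p)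

namespace IsGraph1

/-- With A = z the Levi equation collapses to D_ζ = 0: D depends on z alone. This makes compositions
with D computable in `third_order_comp`. -/
theorem pY_D (h : IsGraph1 F Φ) : pY (jet Φ 0 1) =ᶠ[𝓝 0] fun _ => 0 := by
  filter_upwards [h.levi_jet, pX_congr_fst h.jet_one, pY_congr_fst h.jet_one] with p h1 h2 h3
  rw [h2, h3] at h1
  linear_combination h1

theorem pY_E (h : IsGraph1 F Φ) :
    pY (jet Φ 1 1) =ᶠ[𝓝 0] fun p => pX (jet Φ 0 1) p * pY (jet Φ 2 0) p := by
  filter_upwards [h.levi_jet_deriv, pX_congr_fst h.jet_one, pY_congr_fst h.jet_one, h.pY_D] with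
    p h1 h2 h3 h4
  rw [h2, h3, h4] at h1
  linear_combination h1

theorem pX_D (h : IsGraph1 F Φ) : pX (jet Φ 0 1) 0 = 0 := by
  have := h.ext.jet_conj 1 0 0 1
  simp only [Function.iterate_succ, Function.iterate_zero, Function.comp, id] at this
  rw [this, (pY_congr_fst h.jet_one).eq_of_nhds, map_zero]

theorem pX_C (h : IsGraph1 F Φ) : pX (jet Φ 2 0) 0 = 0 := by
  have := h.ext.jet_conj 1 0 2 0
  simp only [Function.iterate_succ, Function.iterate_zero, Function.comp, id] at this
  have h0 : pX (pX (jet Φ 1 0)) 0 = 0 := (pd_congr_const (pX_congr_fst h.jet_one) _).eq_of_nhds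
  rw [this, h0, map_zero]

theorem pY_C (h : IsGraph1 F Φ) :
    pY (jet Φ 2 0) 0 = starRingEnd ℂ (pX (pX (jet Φ 0 1)) 0) := by
  have := h.ext.jet_conj 0 1 2 0
  simpa only [Function.iterate_succ, Function.iterate_zero, Function.comp, id] using this

theorem analytic_D (h : IsGraph1 F Φ) : AnalyticAt ℂ (jet Φ 0 1) 0 :=
  analyticAt_jet h.ext.analytic 0 1

end IsGraph1

/-- A composition with a function of `z` alone, up to third order. -/
theorem third_order_comp {T : RigidTransformation} {u : ℂ × ℂ → ℂ} (hu : AnalyticAt ℂ u 0)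
    (hY : pY u =ᶠ[𝓝 0] fun _ => 0) (hX : pX u 0 = 0) :
    pX (pX (fun p => u (T.map p))) 0 = pX (pX u) 0 * pX T.f 0 ^ 2 ∧
    pX (pX (pX (fun p => u (T.map p)))) 0 = pX (pX (pX u)) 0 * pX T.f 0 ^ 3
      + 3 * pX (pX u) 0 * pX T.f 0 * pX (pX T.f) 0 := by
  have hu' : AnalyticAt ℂ u (T.f 0, T.g 0) := by rw [T.f_zero, T.g_zero]; exact hu
  have h2 := pXX_comp hu' T.f_analytic T.g_analytic
  have h3 := pXXX_comp hu' T.f_analytic T.g_analytic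
  have hX1 := pd_congr_const hY (1, 0)
  have hY1 := pd_congr_const hY (0, 1)
  have k1 : pX (pY u) 0 = 0 := hX1.eq_of_nhds
  have k2 : pY (pY u) 0 = 0 := hY1.eq_of_nhds
  have k3 : pX (pX (pY u)) 0 = 0 := (pd_congr_const hX1 _).eq_of_nhds
  have k4 : pX (pY (pY u)) 0 = 0 := (pd_congr_const hY1 _).eq_of_nhds
  have k5 : pY (pY (pY u)) 0 = 0 := (pd_congr_const hY1 _).eq_of_nhds
  have k6 : pY u 0 = 0 := hY.eq_of_nhds
  rw [T.f_zero, T.g_zero, Prod.mk_zero_zero] at h2 h3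
  simp only [k1, k2, k6, hX] at h2
  simp only [k1, k2, k3, k4, k5, k6, hX] at h3
  exact ⟨h2.trans (by ring), h3.trans (by ring)⟩

theorem pd_lin {u w : ℂ × ℂ → ℂ} {x : ℂ × ℂ} (hu : AnalyticAt ℂ u x) (hw : AnalyticAt ℂ w x)
    (a b : ℂ) (v : ℂ × ℂ) :
    pd v (fun p => a * u p + b * w p) =ᶠ[𝓝 x] fun p => a * pd v u p + b * pd v w p := by
  filter_upwards [hu.eventually_analyticAt, hw.eventually_analyticAt] with p h1 h2
  rw [pd_add (analyticAt_const.fun_mul h1) (analyticAt_const.fun_mul h2), pd_const_mul _ h1,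
    pd_const_mul _ h2]

theorem iterate_pd_lin {u w : ℂ × ℂ → ℂ} {x : ℂ × ℂ} (hu : AnalyticAt ℂ u x)
    (hw : AnalyticAt ℂ w x) (a b : ℂ) (v : ℂ × ℂ) (n : ℕ) :
    (pd v)^[n] (fun p => a * u p + b * w p) =ᶠ[𝓝 x]
      fun p => a * (pd v)^[n] u p + b * (pd v)^[n] w p := by
  induction n with
  | zero => rfl
  | succ n ih =>
    simp only [Function.iterate_succ_apply']
    exact (pd_congr ih v).trans
      (pd_lin (analyticAt_iterate_pd hu v n) (analyticAt_iterate_pd hw v n) a b v)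

theorem pX_lin {u w : ℂ × ℂ → ℂ} {x : ℂ × ℂ} (hu : AnalyticAt ℂ u x) (hw : AnalyticAt ℂ w x)
    (a b : ℂ) : pX (fun p => a * u p + b * w p) x = a * pX u x + b * pX w x :=
  (pd_lin hu hw a b _).eq_of_nhds

theorem pY_lin {u w : ℂ × ℂ → ℂ} {x : ℂ × ℂ} (hu : AnalyticAt ℂ u x) (hw : AnalyticAt ℂ w x)
    (a b : ℂ) : pY (fun p => a * u p + b * w p) x = a * pY u x + b * pY w x :=
  (pd_lin hu hw a b _).eq_of_nhds

theorem pXX_lin {u w : ℂ × ℂ → ℂ} {x : ℂ × ℂ} (hu : AnalyticAt ℂ u x) (hw : AnalyticAt ℂ w x)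
    (a b : ℂ) :
    pX (pX fun p => a * u p + b * w p) x = a * pX (pX u) x + b * pX (pX w) x :=
  (iterate_pd_lin hu hw a b _ 2).eq_of_nhds

theorem pXXX_lin {u w : ℂ × ℂ → ℂ} {x : ℂ × ℂ} (hu : AnalyticAt ℂ u x) (hw : AnalyticAt ℂ w x)
    (a b : ℂ) : pX (pX (pX fun p => a * u p + b * w p)) x =
      a * pX (pX (pX u)) x + b * pX (pX (pX w)) x :=
  (iterate_pd_lin hu hw a b _ 3).eq_of_nhds

end JetRelations

/-! ### The normal form in terms of jets -/

/-- Iterated derivatives of the first coordinate at the origin. -/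
theorem iterate_pd_fst (a b : ℕ) :
    pX^[a] (pY^[b] fun p : ℂ × ℂ => p.1) 0 = if (a, b) = (1, 0) then 1 else 0 := by
  have hY : ∀ n, pY^[n + 1] (fun p : ℂ × ℂ => p.1) = fun _ => 0 := by
    intro n
    rw [Function.iterate_succ_apply, show pY (fun p : ℂ × ℂ => p.1) = fun _ => 0 from
      funext pY_fst, iterate_pd_zero]
  have hX : ∀ n, pX^[n + 2] (fun p : ℂ × ℂ => p.1) = fun _ => 0 := by
    intro n
    rw [Function.iterate_succ_apply, Function.iterate_succ_apply,
      show pX (fun p : ℂ × ℂ => p.1) = fun _ => 1 from funext pX_fst,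
      show pX (fun _ : ℂ × ℂ => (1 : ℂ)) = fun _ => 0 from funext (pd_const 1 _), iterate_pd_zero]
  rcases b with _ | b
  · rcases a with _ | _ | a
    · simp
    · simpa using pX_fst 0
    · have := congrFun (hX a) 0
      simpa using this
  · rw [hY, iterate_pd_zero]
    simp

/-- Iterated derivatives of the second coordinate at the origin. -/
theorem iterate_pd_snd (a b : ℕ) :
    pX^[a] (pY^[b] fun p : ℂ × ℂ => p.2) 0 = if (a, b) = (0, 1) then 1 else 0 := by
  have hY : ∀ n, pY^[n + 2] (fun p : ℂ × ℂ => p.2) = fun _ => 0 := by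
    intro n
    rw [Function.iterate_succ_apply, Function.iterate_succ_apply,
      show pY (fun p : ℂ × ℂ => p.2) = fun _ => 1 from funext pY_snd,
      show pY (fun _ : ℂ × ℂ => (1 : ℂ)) = fun _ => 0 from funext (pd_const 1 _), iterate_pd_zero]
  have hX0 : pX (fun p : ℂ × ℂ => p.2) = fun _ => 0 := funext pX_snd
  have hX1 : pX (fun _ : ℂ × ℂ => (1 : ℂ)) = fun _ => 0 := funext (pd_const 1 _)
  rcases b with _ | _ | b
  · rcases a with _ | a
    · simp
    · rw [Function.iterate_zero, id, Function.iterate_succ_apply, hX0, iterate_pd_zero]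
      simp
  · rw [zero_add, Function.iterate_one, show pY (fun p : ℂ × ℂ => p.2) = fun _ => 1 from
      funext pY_snd]
    rcases a with _ | a
    · simp
    · rw [Function.iterate_succ_apply, hX1, iterate_pd_zero]
      simp
  · rw [hY, iterate_pd_zero]
    simp

/-- The normal form of the space `ℋ⁽⁷⁾`, expressed through the jets of the complexification. -/
structure IsNormal (F : ℂ × ℂ → ℝ) (Φ : Cx → ℂ) : Prop extends IsGraph1 F Φ where
  jet_two : jet Φ 2 0 =ᶠ[𝓝 0] fun p => p.2
  third_D : pX (pX (pX (jet Φ 0 1))) 0 = 0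
  third_E : starRingEnd ℂ (pX (pX (pX (jet Φ 1 1))) 0) = pX (pX (pX (jet Φ 1 1))) 0

theorem IsGraph1.second_D {F : ℂ × ℂ → ℝ} {Φ : Cx → ℂ} (h : IsGraph1 F Φ)
    (h2 : jet Φ 2 0 =ᶠ[𝓝 0] fun p => p.2) : pX (pX (jet Φ 0 1)) 0 = 1 := by
  have h1 := h.pY_C
  rw [(pY_congr_snd h2).eq_of_nhds] at h1
  have := congrArg (starRingEnd ℂ) h1
  simpa using this.symm

/-- The coefficient conditions fix the full Taylor series of A and C. By Hermitian symmetry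
F_{1,1,3,0} is the conjugate of F_{3,0,1,1}, so the last normalization says that E_zzz(0) is real.
-/
theorem MemH7.exists_isNormal {F : ℂ × ℂ → ℝ} (h : MemH7 F) : ∃ Φ, IsNormal F Φ := by
  obtain ⟨Φ, hΦ⟩ := h.toMemH.exists_isGraph
  have hc := coeff_eq_jet hΦ.ext
  refine ⟨Φ, ⟨⟨hΦ, ?_⟩, ?_, ?_, ?_⟩⟩
  · refine eventually_eq_of_iterate_pd (analyticAt_jet hΦ.ext.analytic 1 0) analyticAt_fst
      fun a b => ?_
    rw [← hc, iterate_pd_fst]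
    split_ifs with hab
    · obtain ⟨rfl, rfl⟩ := Prod.mk.inj hab
      exact h.coeff_1010
    · exact h.coeff_one a b hab
  · refine eventually_eq_of_iterate_pd (analyticAt_jet hΦ.ext.analytic 2 0) analyticAt_snd
      fun a b => ?_
    rw [← hc, iterate_pd_snd]
    split_ifs with hab
    · obtain ⟨rfl, rfl⟩ := Prod.mk.inj hab
      exact h.coeff_0120
    · exact h.coeff_two a b hab
  · have := h.coeff_3001
    rwa [hc] at this
  · have := h.coeff_3011
    rw [coeff_conj hΦ.ext 3 0 1 1, hc] at this
    exact this.symm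

/-- The conditions of ℋ are automatic: F_{z z̄}(0) = 1 keeps the rank of the degenerate Levi matrix
equal to 1 nearby, and A_zz = 0, D_zz(0) = 1 make the 2-nondegeneracy determinant 1. -/
theorem IsNormal.memH7 {F : ℂ × ℂ → ℝ} {Φ : Cx → ℂ} (h : IsNormal F Φ) : MemH7 F := by
  have hc := coeff_eq_jet h.ext
  have h1 : ∀ a b, coeff F a b 1 0 = if (a, b) = (1, 0) then 1 else 0 := fun a b => by
    rw [hc, (iterate_pd_congr (iterate_pd_congr h.jet_one _ b) _ a).eq_of_nhds, iterate_pd_fst]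
  have h2 : ∀ a b, coeff F a b 2 0 = if (a, b) = (0, 1) then 1 else 0 := fun a b => by
    rw [hc, (iterate_pd_congr (iterate_pd_congr h.jet_two _ b) _ a).eq_of_nhds, iterate_pd_snd]
  have h1010 : coeff F 1 0 1 0 = 1 := by simpa using h1 1 0
  have hF0 : F 0 = 0 := by
    have := h.ext.apply_zero
    rw [show Φ 0 = 0 from h.harmonic.self_of_nhds] at this
    exact_mod_cast this
  refine { analytic := h.real_analytic, map_zero := hF0, no_harmonic := fun a b => ?_,
           levi_rank_one := ?_, two_nondegenerate := ?_, coeff_one := fun a b hab => ?_,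
           coeff_1010 := h1010, coeff_two := fun a b hab => ?_, coeff_0120 := ?_,
           coeff_3001 := ?_, coeff_3011 := ?_ }
  · rw [hc]; exact h.coeff_harmonic a b
  · have hcont : ContinuousAt (fun p => D1 (D3 Φ) (p, bar p)) 0 := by
      have han : AnalyticAt ℂ (D1 (D3 Φ)) 0 := analyticAt_pd (analyticAt_pd h.ext.analytic _) _
      refine ContinuousAt.comp (g := D1 (D3 Φ)) ?_
        (by fun_prop : Continuous fun p : ℂ × ℂ => (p, bar p)).continuousAt
      rw [map_zero]
      exact han.continuousAt
    have h0 : D1 (D3 Φ) ((0 : ℂ × ℂ), bar 0) ≠ 0 := by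
      have := (h.ext.mixedDeriv 1 0 1 0).eq_bar.self_of_nhds
      rw [show D1 (D3 Φ) ((0 : ℂ × ℂ), bar 0) = coeff F 1 0 1 0 from this.symm, h1010]
      exact one_ne_zero
    filter_upwards [extends_leviDet h.ext, tendsto_prod_bar.eventually h.levi,
      hcont.eventually_ne h0, (h.ext.mixedDeriv 1 0 1 0).eq_bar] with p e1 e2 e3 e4
    refine rank_eq_one_of_det_eq_zero (e1.trans e2) ?_
    change mixedDeriv F 1 0 1 0 p ≠ 0
    rw [e4]
    exact e3
  · rw [Matrix.isUnit_iff_isUnit_det, Matrix.det_fin_two_of, h1010, h1 2 0,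
      show coeff F 2 0 0 1 = 1 from (hc 2 0 0 1).trans (h.second_D h.jet_two)]
    simp
  · rw [h1, if_neg hab]
  · rw [h2, if_neg hab]
  · simpa using h2 0 1
  · rw [hc]; exact h.third_D
  · rw [coeff_conj h.ext 3 0 1 1, hc]; exact h.third_E.symm

/-! ### Existence: the three normalization steps -/

/-- First normalization step, with `f = ∂_z̄ Φ(z, ζ, 0, 0)`. -/
theorem MemH.exists_isGraph1 {F : ℂ × ℂ → ℝ} (hF : MemH F) :
    ∃ (T : RigidTransformation) (G : ℂ × ℂ → ℝ) (Ψ : Cx → ℂ), T.Sends F G ∧ IsGraph1 G Ψ ∧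
      pX (pX (jet Ψ 0 1)) 0 ≠ 0 := by
  obtain ⟨Φ, h⟩ := hF.exists_isGraph
  have hc := coeff_eq_jet h.ext
  have hA := analyticAt_jet h.ext.analytic 1 0
  have hD := analyticAt_jet h.ext.analytic 0 1
  set A := jet Φ 1 0 with hA_def
  set D := jet Φ 0 1 with hD_def
  have hdet := ((Matrix.isUnit_iff_isUnit_det _).1 hF.two_nondegenerate).ne_zero
  rw [Matrix.det_fin_two_of, hc, hc, hc, hc] at hdet
  change pX A 0 * pX (pX D) 0 - pX D 0 * pX (pX A) 0 ≠ 0 at hdet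
  have hlevi : pX A 0 * pY D 0 - pX D 0 * pY A 0 = 0 := h.levi_jet.self_of_nhds
  have hDA : pY A 0 = starRingEnd ℂ (pX D 0) := h.ext.jet_conj 0 1 1 0
  have hAA : pX A 0 = starRingEnd ℂ (pX A 0) := h.ext.jet_conj 1 0 1 0
  -- If A_z(0) = 0, the Levi equation gives |D_z(0)|² = 0, and the first row of the 2-nondegeneracy
  -- matrix vanishes.
  have hA0 : pX A 0 ≠ 0 := by
    intro h0
    rw [h0, hDA, zero_mul, zero_sub, neg_eq_zero, Complex.mul_conj, Complex.ofReal_eq_zero,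
      Complex.normSq_eq_zero] at hlevi
    rw [h0, hlevi] at hdet
    simp at hdet
  -- The choice ρ = r = A_z(0), which is real, cancels the factor conj f_z(0) in the first relation:
  -- A' along the map equals A = f, hence A' = z.
  obtain ⟨r, hr⟩ := Complex.conj_eq_iff_real.1 hAA.symm
  have hr0 : r ≠ 0 := by
    rintro rfl
    exact hA0 (by simpa using hr)
  have hjac : jac A (fun p => p.2) 0 ≠ 0 := by
    rw [jac, pY_snd, pX_snd]
    simpa using hA0
  obtain ⟨T, hTf, hTg, hTρ⟩ := exists_rigidTransformation hA analyticAt_snd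
    (h.jet_apply_zero 1 0) rfl hjac hr0
  obtain ⟨G, Ψ, hG, hs⟩ := T.exists_sends h
  have hfirst := hs.jet_first h.ext hG.ext
  rw [hTf, hTg, hTρ, pX_snd, pY_snd, ← hAA, hr] at hfirst
  have hone : jet Ψ 1 0 =ᶠ[𝓝 0] fun p => p.1 := by
    refine T.eventually_map.1 ?_
    filter_upwards [hfirst] with p hp
    have h1 : (r : ℂ) * (jet Ψ 1 0 (T.map p) - A p) = 0 := by
      have := hp.1
      rw [_root_.map_zero, mul_zero, add_zero] at this
      linear_combination this
    have h2 := (mul_eq_zero.1 h1).resolve_left (by exact_mod_cast hr0)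
    rw [sub_eq_zero.1 h2, RigidTransformation.map, hTf]
  have h1 : IsGraph1 G Ψ := ⟨hG, hone⟩
  refine ⟨T, G, Ψ, hs, h1, fun hzero => hdet ?_⟩
  have hone' := T.eventually_map.2 hone
  have hD' : (fun p => jet Ψ 0 1 (T.map p)) =ᶠ[𝓝 0]
      fun p => (r : ℂ) * D p + (-starRingEnd ℂ (pY A 0)) * A p := by
    filter_upwards [hfirst, hone'] with p hp hp'
    have := hp.2
    rw [hp', show (T.map p).1 = A p from congrFun hTf p, map_one, mul_one, ← hD_def] at this
    linear_combination this
  have hΨD := h1.analytic_D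
  have e1 : pX (fun p => jet Ψ 0 1 (T.map p)) 0 = 0 := by
    have hu : AnalyticAt ℂ (jet Ψ 0 1) (T.f 0, T.g 0) := by rw [T.f_zero, T.g_zero]; exact hΨD
    refine (pd_comp_pair hu T.f_analytic T.g_analytic _).trans ?_
    rw [T.f_zero, T.g_zero, Prod.mk_zero_zero, h1.pX_D, h1.pY_D.eq_of_nhds]
    ring
  have e2 := (third_order_comp (T := T) hΨD h1.pY_D h1.pX_D).1
  rw [hzero, zero_mul] at e2
  -- If D'_zz(0) = 0, a combination rD - c̄A with r ≠ 0 has vanishing z- and zz-derivatives at 0, so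
  -- the two columns of the 2-nondegeneracy matrix are proportional.
  have f1 := e1.symm.trans ((pd_congr_at hD' (1, 0)).trans (pX_lin hD hA _ _))
  have f2 := e2.symm.trans ((iterate_pd_congr hD' (1, 0) 2).eq_of_nhds.trans (pXX_lin hD hA _ _))
  have hr' : (r : ℂ) ≠ 0 := by exact_mod_cast hr0
  refine (mul_eq_zero.1 (?_ : (r : ℂ) * _ = 0)).resolve_left hr'
  linear_combination pX (pX A) 0 * f1 - pX A 0 * f2

/-- Second normalization step. -/
theorem IsGraph1.exists_third {F : ℂ × ℂ → ℝ} {Φ : Cx → ℂ} (h : IsGraph1 F Φ)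
    (hne : pX (pX (jet Φ 0 1)) 0 ≠ 0) :
    ∃ (T : RigidTransformation) (G : ℂ × ℂ → ℝ) (Ψ : Cx → ℂ), T.Sends F G ∧ IsGraph1 G Ψ ∧
      pX (pX (jet Ψ 0 1)) 0 = 1 ∧ pX (pX (pX (jet Ψ 0 1))) 0 = 0 := by
  have hD := h.analytic_D
  set D := jet Φ 0 1 with hD_def
  set δ : ℂ := pX (pX D) 0 with hδ
  -- The relations give D' = D/δ along the map; since f_zz(0) = -cδ, the third derivative reads
  -- D'_zzz(0) - 3cδ = D_zzz(0)/δ. This c makes D'_zzz(0) zero. The slope conj(cδ) of g is what the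
  -- first relation needs for A' = z to persist.
  set c : ℂ := -pX (pX (pX D)) 0 / (3 * δ ^ 2) with hc
  have hf : AnalyticAt ℂ (fun p : ℂ × ℂ => 1 * p.1 + (-c) * D p) 0 :=
    (analyticAt_const.fun_mul analyticAt_fst).fun_add (analyticAt_const.fun_mul hD)
  have hg : AnalyticAt ℂ (fun p : ℂ × ℂ => starRingEnd ℂ (c * δ) * p.1 + starRingEnd ℂ δ * p.2) 0 :=
    (analyticAt_const.fun_mul analyticAt_fst).fun_add (analyticAt_const.fun_mul analyticAt_snd)
  have hD0 : D 0 = 0 := h.jet_apply_zero 0 1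
  have hfX : pX (fun p : ℂ × ℂ => 1 * p.1 + (-c) * D p) 0 = 1 := by
    rw [pX_lin analyticAt_fst hD, pX_fst, h.pX_D]; ring
  have hfY : pY (fun p : ℂ × ℂ => 1 * p.1 + (-c) * D p) 0 = 0 := by
    rw [pY_lin analyticAt_fst hD, pY_fst, h.pY_D.eq_of_nhds]; ring
  have hfXX : pX (pX (fun p : ℂ × ℂ => 1 * p.1 + (-c) * D p)) 0 = -c * δ := by
    rw [pXX_lin analyticAt_fst hD,
      show pX (pX fun p : ℂ × ℂ => p.1) 0 = _ from iterate_pd_fst 2 0, hδ]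
    simp
  have hgX : pX (fun p : ℂ × ℂ => starRingEnd ℂ (c * δ) * p.1 + starRingEnd ℂ δ * p.2) 0 =
      starRingEnd ℂ (c * δ) := by
    rw [pX_lin analyticAt_fst analyticAt_snd, pX_fst, pX_snd]
    ring
  have hgY : pY (fun p : ℂ × ℂ => starRingEnd ℂ (c * δ) * p.1 + starRingEnd ℂ δ * p.2) 0 =
      starRingEnd ℂ δ := by
    rw [pY_lin analyticAt_fst analyticAt_snd, pY_fst, pY_snd]
    ring
  obtain ⟨T, hTf, hTg, hTρ⟩ := exists_rigidTransformation (ρ := 1) hf hg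
    (by simp [hD0]) (by simp) (by
      rw [jac, hfX, hfY, hgX, hgY]
      simpa using hne) one_ne_zero
  obtain ⟨G, Ψ, hG, hs⟩ := T.exists_sends h.toIsGraph
  have hfirst := hs.jet_first h.ext hG.ext
  rw [hTf, hTg, hTρ, hfX, hfY, hgX, hgY] at hfirst
  simp only [map_one, map_zero, Complex.conj_conj, Complex.ofReal_one, one_mul, mul_one, mul_zero,
    zero_add] at hfirst
  have hone : jet Ψ 1 0 =ᶠ[𝓝 0] fun p => p.1 := by
    refine T.eventually_map.1 ?_
    filter_upwards [hfirst, h.jet_one] with p hp hp'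
    rw [hp'] at hp
    simp only [RigidTransformation.map, hTf] at hp ⊢
    linear_combination hp.1 - c * hp.2
  have h1 : IsGraph1 G Ψ := ⟨hG, hone⟩
  -- The null summand only gives the two-term shape required by `pXX_lin` and `pXXX_lin`.
  have hD' : (fun p => jet Ψ 0 1 (T.map p)) =ᶠ[𝓝 0] fun p => δ⁻¹ * D p + 0 * D p := by
    filter_upwards [hfirst] with p hp
    rw [hD_def, ← hp.2]
    field_simp
    ring
  have e := third_order_comp (T := T) h1.analytic_D h1.pY_D h1.pX_D
  rw [hTf, hfX, hfXX] at e
  have f2 : pX (pX (fun p => jet Ψ 0 1 (T.map p))) 0 = δ⁻¹ * pX (pX D) 0 + 0 * pX (pX D) 0 :=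
    (iterate_pd_congr hD' (1, 0) 2).eq_of_nhds.trans (pXX_lin hD hD _ _)
  have f3 : pX (pX (pX (fun p => jet Ψ 0 1 (T.map p)))) 0 =
      δ⁻¹ * pX (pX (pX D)) 0 + 0 * pX (pX (pX D)) 0 :=
    (iterate_pd_congr hD' (1, 0) 3).eq_of_nhds.trans (pXXX_lin hD hD _ _)
  rw [e.1] at f2
  rw [e.2] at f3
  have h2 : pX (pX (jet Ψ 0 1)) 0 = 1 := by
    rw [← hδ, inv_mul_cancel₀ hne] at f2
    linear_combination f2
  refine ⟨T, G, Ψ, hs, h1, h2, ?_⟩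
  rw [h2] at f3
  have hcδ : 3 * c * δ = -(δ⁻¹ * pX (pX (pX D)) 0) := by
    rw [hc]; field_simp
  linear_combination f3 + hcδ

/-- The relation between third order jets of `∂_z̄∂_ζ̄ Φ` under a transformation tangent to a
diagonal one. -/
theorem IsGraph1.third_E_comp {G : ℂ × ℂ → ℝ} {Ψ : Cx → ℂ} (h : IsGraph1 G Ψ)
    (h2 : jet Ψ 2 0 =ᶠ[𝓝 0] fun p => p.2) {T : RigidTransformation}
    (hg : pX T.g 0 = 0) (hff : pX (pX T.f) 0 = 0)
    (hfff : pX (pX (pX T.f)) 0 = 0) :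
    pX (pX (pX (fun p => jet Ψ 1 1 (T.map p)))) 0 =
      pX (pX (pX (jet Ψ 1 1))) 0 * pX T.f 0 ^ 3 + 3 * pX T.f 0 * pX (pX T.g) 0 := by
  have hu : AnalyticAt ℂ (jet Ψ 1 1) (T.f 0, T.g 0) := by
    rw [T.f_zero, T.g_zero]; exact analyticAt_jet h.ext.analytic 1 1
  have h3 := pXXX_comp hu T.f_analytic T.g_analytic
  rw [T.f_zero, T.g_zero, Prod.mk_zero_zero] at h3
  have hY : pY (jet Ψ 1 1) =ᶠ[𝓝 0] pX (jet Ψ 0 1) := by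
    filter_upwards [h.pY_E, pY_congr_snd h2] with p e1 e2
    rw [e1, e2, mul_one]
  -- As C = ζ, E_ζ = D_z: it vanishes at 0 and has z-derivative D_zz(0) = 1. The latter couples
  -- E_zzz(0) to g_zz(0).
  have hY0 : pY (jet Ψ 1 1) 0 = 0 := hY.eq_of_nhds.trans h.pX_D
  have hXY : pX (pY (jet Ψ 1 1)) 0 = 1 := (pd_congr_at hY _).trans (h.second_D h2)
  simp only [hg, hff, hfff, hY0, hXY] at h3
  exact h3.trans (by ring)

/-- Third normalization step. -/
theorem IsGraph1.exists_isNormal {F : ℂ × ℂ → ℝ} {Φ : Cx → ℂ} (h : IsGraph1 F Φ)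
    (h2 : pX (pX (jet Φ 0 1)) 0 = 1) (h3 : pX (pX (pX (jet Φ 0 1))) 0 = 0) :
    ∃ (T : RigidTransformation) (G : ℂ × ℂ → ℝ) (Ψ : Cx → ℂ), T.Sends F G ∧ IsNormal G Ψ := by
  have hD := h.analytic_D
  have hC := analyticAt_jet h.ext.analytic 2 0
  have hE := analyticAt_jet h.ext.analytic 1 1
  set D := jet Φ 0 1 with hD_def
  set C := jet Φ 2 0 with hC_def
  set E := jet Φ 1 1 with hE_def
  have hCC : pX (pX C) 0 = starRingEnd ℂ (pX (pX C) 0) := h.ext.jet_conj 2 0 2 0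
  -- κ is the intended g_zz(0). Its real part C_zz(0)/2 is forced by consistency: g = C - κ̄D has
  -- g_zz(0) = C_zz(0) - κ̄. Its imaginary part is free, and is taken to be a third of that of
  -- E_zzz(0) because E'_zzz(0) = E_zzz(0) - 3κ.
  set κ : ℂ := pX (pX C) 0 / 2
    + (pX (pX (pX E)) 0 - starRingEnd ℂ (pX (pX (pX E)) 0)) / 6 with hκ
  have hκ' : starRingEnd ℂ κ = pX (pX C) 0 / 2
      - (pX (pX (pX E)) 0 - starRingEnd ℂ (pX (pX (pX E)) 0)) / 6 := by
    rw [hκ, map_add, map_div₀, map_div₀, map_sub, Complex.conj_conj, ← hCC,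
      show starRingEnd ℂ (2 : ℂ) = 2 from Complex.conj_ofNat 2,
      show starRingEnd ℂ (6 : ℂ) = 6 from Complex.conj_ofNat 6]
    ring
  have hg : AnalyticAt ℂ (fun p : ℂ × ℂ => 1 * C p + (-starRingEnd ℂ κ) * D p) 0 :=
    (analyticAt_const.fun_mul hC).fun_add (analyticAt_const.fun_mul hD)
  have hgX : pX (fun p : ℂ × ℂ => 1 * C p + (-starRingEnd ℂ κ) * D p) 0 = 0 := by
    rw [pX_lin hC hD, h.pX_C, h.pX_D]; ring
  have hgY : pY (fun p : ℂ × ℂ => 1 * C p + (-starRingEnd ℂ κ) * D p) 0 = 1 := by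
    rw [pY_lin hC hD, h.pY_C, h.pY_D.eq_of_nhds, ← hD_def, h2, map_one]; ring
  have hgXX : pX (pX (fun p : ℂ × ℂ => 1 * C p + (-starRingEnd ℂ κ) * D p)) 0 = κ := by
    rw [pXX_lin hC hD, h2, hκ', hκ]; ring
  have hfX : pX (fun p : ℂ × ℂ => p.1) 0 = 1 := pX_fst 0
  have hfY : pY (fun p : ℂ × ℂ => p.1) 0 = 0 := pY_fst 0
  have hfXX : pX (pX (fun p : ℂ × ℂ => p.1)) 0 = 0 := by simpa using iterate_pd_fst 2 0
  have hfXY : pX (pY (fun p : ℂ × ℂ => p.1)) 0 = 0 := by simpa using iterate_pd_fst 1 1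
  have hfXXX : pX (pX (pX (fun p : ℂ × ℂ => p.1))) 0 = 0 := by simpa using iterate_pd_fst 3 0
  obtain ⟨T, hTf, hTg, hTρ⟩ := exists_rigidTransformation (ρ := 1) analyticAt_fst hg rfl
    (by rw [show C 0 = 0 from h.jet_apply_zero 2 0, show D 0 = 0 from h.jet_apply_zero 0 1]; ring)
    (by rw [jac, hfX, hfY, hgX, hgY]; norm_num) one_ne_zero
  obtain ⟨G, Ψ, hG, hs⟩ := T.exists_sends h.toIsGraph
  have hfirst := hs.jet_first h.ext hG.ext
  have hsecond := hs.jet_second h.ext hG.ext (by rw [hTg, hgX])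
  set c : ℂ := pX (pY T.g) 0
  rw [hTf, hTg, hTρ, hfX, hfY, hgX, hgY] at hfirst
  rw [hTf, hTg, hTρ, hfX, hfY, hfXX, hfXY, hgXX, hgY] at hsecond
  simp only [map_one, map_zero, Complex.ofReal_one, one_mul, mul_one, mul_zero,
    zero_add, add_zero, one_pow] at hfirst hsecond
  have hone : jet Ψ 1 0 =ᶠ[𝓝 0] fun p => p.1 := by
    refine T.eventually_map.1 ?_
    filter_upwards [hfirst, h.jet_one] with p hp hp'
    rw [hp.1, hp']
    exact (congrFun hTf p).symm
  have htwo : jet Ψ 2 0 =ᶠ[𝓝 0] fun p => p.2 := by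
    refine T.eventually_map.1 ?_
    filter_upwards [hfirst, hsecond] with p hp hp'
    refine Eq.trans ?_ (congrFun hTg p).symm
    rw [hD_def, hC_def, ← hp.2]
    linear_combination hp'.1
  have h1 : IsGraph1 G Ψ := ⟨hG, hone⟩
  have hD' : (fun p => jet Ψ 0 1 (T.map p)) =ᶠ[𝓝 0] D := by
    filter_upwards [hfirst] with p hp using hp.2
  have e := third_order_comp (T := T) h1.analytic_D h1.pY_D h1.pX_D
  rw [hTf, hfX, hfXX] at e
  have f3 : pX (pX (pX (fun p => jet Ψ 0 1 (T.map p)))) 0 = pX (pX (pX D)) 0 :=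
    (iterate_pd_congr hD' (1, 0) 3).eq_of_nhds
  have h3' : pX (pX (pX (jet Ψ 0 1))) 0 = 0 := by
    rw [e.2, h3] at f3
    linear_combination f3
  have e' := h1.third_E_comp htwo (T := T) (by rw [hTg, hgX]) (by rw [hTf, hfXX])
    (by rw [hTf, hfXXX])
  rw [hTf, hTg, hfX, hgXX] at e'
  have hE' : (fun p => jet Ψ 1 1 (T.map p)) =ᶠ[𝓝 0] fun p => 1 * E p + (-starRingEnd ℂ c) * D p := by
    filter_upwards [hfirst, hsecond] with p hp hp'
    have := hp'.2
    rw [hp.2] at this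
    rw [hE_def, ← this]
    ring
  have f4 := (iterate_pd_congr hE' (1, 0) 3).eq_of_nhds.trans (pXXX_lin hE hD _ _)
  have f5 := e'.symm.trans f4
  rw [h3] at f5
  have f6 : pX (pX (pX (jet Ψ 1 1))) 0 = (pX (pX (pX E)) 0 + starRingEnd ℂ (pX (pX (pX E)) 0)) / 2
      - 3 * pX (pX C) 0 / 2 := by
    rw [hκ] at f5
    linear_combination f5
  refine ⟨T, G, Ψ, hs, h1, htwo, h3', ?_⟩
  rw [f6, map_sub, map_div₀, map_div₀, map_add, map_mul, Complex.conj_conj, ← hCC,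
    show starRingEnd ℂ (2 : ℂ) = 2 from Complex.conj_ofNat 2,
    show starRingEnd ℂ (3 : ℂ) = 3 from Complex.conj_ofNat 3]
  ring

theorem MemH.exists_memH7 {F : ℂ × ℂ → ℝ} (hF : MemH F) :
    ∃ (T : RigidTransformation) (G : ℂ × ℂ → ℝ), MemH7 G ∧ T.Sends F G := by
  obtain ⟨T₁, G₁, Ψ₁, hs₁, h₁, hne⟩ := hF.exists_isGraph1
  obtain ⟨T₂, G₂, Ψ₂, hs₂, h₂, e₂, e₃⟩ := h₁.exists_third hne
  obtain ⟨T₃, G₃, Ψ₃, hs₃, h₃⟩ := h₂.exists_isNormal e₂ e₃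
  obtain ⟨S, hS, -⟩ := hs₁.exists_comp hs₂
  obtain ⟨R, hR, -⟩ := hS.exists_comp hs₃
  exact ⟨R, G₃, h₃.memH7, hR⟩

/-! ### Non-uniqueness: the dilation -/

/-- The normal form is preserved by the dilation `(z, ζ, w) ↦ (2 z, ζ, 4 w)`. -/
theorem IsNormal.exists_dilate {F : ℂ × ℂ → ℝ} {Φ : Cx → ℂ} (h : IsNormal F Φ) :
    ∃ (T : RigidTransformation) (G : ℂ × ℂ → ℝ), MemH7 G ∧ T.Sends F G ∧ T.ρ = 4 := by
  have hz : AnalyticAt ℂ (fun p : ℂ × ℂ => 2 * p.1 + 0 * p.2) 0 :=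
    (analyticAt_const.fun_mul analyticAt_fst).fun_add (analyticAt_const.fun_mul analyticAt_snd)
  have hfX : pX (fun p : ℂ × ℂ => 2 * p.1 + 0 * p.2) 0 = 2 := by
    rw [pX_lin analyticAt_fst analyticAt_snd, pX_fst]; ring
  have hfY : pY (fun p : ℂ × ℂ => 2 * p.1 + 0 * p.2) 0 = 0 := by
    rw [pY_lin analyticAt_fst analyticAt_snd, pY_fst]; ring
  have hfXX : pX (pX (fun p : ℂ × ℂ => 2 * p.1 + 0 * p.2)) 0 = 0 := by
    rw [pXX_lin analyticAt_fst analyticAt_snd,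
      show pX (pX fun p : ℂ × ℂ => p.1) 0 = _ from iterate_pd_fst 2 0]; simp
  have hfXXX : pX (pX (pX (fun p : ℂ × ℂ => 2 * p.1 + 0 * p.2))) 0 = 0 := by
    rw [pXXX_lin analyticAt_fst analyticAt_snd,
      show pX (pX (pX fun p : ℂ × ℂ => p.1)) 0 = _ from iterate_pd_fst 3 0]; simp
  have hfXY : pX (pY (fun p : ℂ × ℂ => 2 * p.1 + 0 * p.2)) 0 = 0 := by
    have : pY (fun p : ℂ × ℂ => 2 * p.1 + 0 * p.2) =ᶠ[𝓝 0] fun _ => 0 := by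
      refine Filter.Eventually.of_forall fun p => ?_
      rw [pY_lin analyticAt_fst analyticAt_snd, pY_fst]; ring
    exact (pd_congr_const this _).eq_of_nhds
  have hgX : pX (fun p : ℂ × ℂ => p.2) 0 = 0 := pX_snd 0
  have hgY : pY (fun p : ℂ × ℂ => p.2) 0 = 1 := pY_snd 0
  have hgXX : pX (pX (fun p : ℂ × ℂ => p.2)) 0 = 0 := by simpa using iterate_pd_snd 2 0
  have hgXY : pX (pY (fun p : ℂ × ℂ => p.2)) 0 = 0 := by simpa using iterate_pd_snd 1 1
  obtain ⟨T, hTf, hTg, hTρ⟩ := exists_rigidTransformation (ρ := 4) hz analyticAt_snd (by simp) rfl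
    (by rw [jac, hfX, hfY, hgX, hgY]; norm_num) four_ne_zero
  obtain ⟨G, Ψ, hG, hs⟩ := T.exists_sends h.toIsGraph
  have hfirst := hs.jet_first h.ext hG.ext
  have hsecond := hs.jet_second h.ext hG.ext (by rw [hTg, hgX])
  rw [hTf, hTg, hTρ, hfX, hfY, hgX, hgY] at hfirst
  rw [hTf, hTg, hTρ, hfX, hfY, hfXX, hfXY, hgXX, hgY, hgXY] at hsecond
  have h2 : starRingEnd ℂ (2 : ℂ) = 2 := Complex.conj_ofNat 2
  simp only [map_one, map_zero, h2, Complex.ofReal_ofNat, mul_one, mul_zero, zero_add,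
    add_zero] at hfirst hsecond
  have hone : jet Ψ 1 0 =ᶠ[𝓝 0] fun p => p.1 := by
    refine T.eventually_map.1 ?_
    filter_upwards [hfirst, h.jet_one] with p hp hp'
    refine Eq.trans ?_ (congrFun hTf p).symm
    rw [hp'] at hp
    linear_combination hp.1 / 2
  have htwo : jet Ψ 2 0 =ᶠ[𝓝 0] fun p => p.2 := by
    refine T.eventually_map.1 ?_
    filter_upwards [hsecond, h.jet_two] with p hp hp'
    refine Eq.trans ?_ (congrFun hTg p).symm
    rw [hp'] at hp
    linear_combination hp.1 / 4
  have h1 : IsGraph1 G Ψ := ⟨hG, hone⟩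
  have hD := h.analytic_D
  have hE := analyticAt_jet h.ext.analytic 1 1
  have hD' : (fun p => jet Ψ 0 1 (T.map p)) =ᶠ[𝓝 0]
      fun p => 4 * jet Φ 0 1 p + 0 * jet Φ 0 1 p := by
    filter_upwards [hfirst] with p hp
    rw [hp.2]; ring
  have hE' : (fun p => jet Ψ 1 1 (T.map p)) =ᶠ[𝓝 0]
      fun p => 2 * jet Φ 1 1 p + 0 * jet Φ 1 1 p := by
    filter_upwards [hsecond] with p hp
    linear_combination hp.2 / 2
  have e1 := (third_order_comp (T := T) h1.analytic_D h1.pY_D h1.pX_D).2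
  have e2 := h1.third_E_comp htwo (T := T) (by rw [hTg, hgX]) (by rw [hTf, hfXX])
    (by rw [hTf, hfXXX])
  rw [hTf, hfX, hfXX] at e1
  rw [hTf, hTg, hfX, hgXX] at e2
  have f1 := e1.symm.trans
    ((iterate_pd_congr hD' (1, 0) 3).eq_of_nhds.trans (pXXX_lin hD hD _ _))
  have f2 := e2.symm.trans
    ((iterate_pd_congr hE' (1, 0) 3).eq_of_nhds.trans (pXXX_lin hE hE _ _))
  rw [h.third_D] at f1
  -- The cubic coefficient is rescaled by the real factor 2/2³ and so stays real.
  have f3 : pX (pX (pX (jet Ψ 1 1))) 0 = pX (pX (pX (jet Φ 1 1))) 0 / 4 := by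
    linear_combination f2 / 8
  refine ⟨T, G, IsNormal.memH7 (Φ := Ψ) ⟨h1, htwo, ?_, ?_⟩, hs, hTρ⟩
  · linear_combination f1 / 8
  · rw [f3, map_div₀, h.third_E, show starRingEnd ℂ (4 : ℂ) = 4 from Complex.conj_ofNat 4]

/-! ### Rigidity: transformations between normal forms -/

/-- Transformations between normal forms are diagonal. -/
theorem IsNormal.sends_eq {F G : ℂ × ℂ → ℝ} {Φ Ψ : Cx → ℂ} (h : IsNormal F Φ) (h' : IsNormal G Ψ)
    {T : RigidTransformation} (hs : T.Sends F G) :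
    ∃ α : ℂ, α ≠ 0 ∧ (T.ρ : ℂ) = α * starRingEnd ℂ α ∧ (∀ᶠ p in 𝓝 0, T.f p = α * p.1) ∧
      ∀ᶠ p in 𝓝 0, starRingEnd ℂ α * T.g p = α * p.2 := by
  have hfirst := hs.jet_first h.ext h'.ext
  have hD := h.analytic_D
  have hD' := h'.analytic_D
  set α := pX T.f 0 with hα
  set β := pY T.f 0 with hβ
  set γ := pX T.g 0 with hγ
  set δ := pY T.g 0 with hδ
  have hρ : (T.ρ : ℂ) ≠ 0 := by exact_mod_cast T.ρ_ne_zero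
  have hDT : AnalyticAt ℂ (fun p => jet Ψ 0 1 (T.map p)) 0 :=
    analyticAt_comp_pair (by rw [T.f_zero, T.g_zero]; exact hD') T.f_analytic T.g_analytic
  have hone := T.eventually_map.2 h'.jet_one
  -- The first-order relations with A = z and A' = z: ᾱf + γ̄D' = ρz and β̄f + δ̄D' = ρD, where D'
  -- is taken along the map. As D' starts at order two, linear terms give ᾱα = ρ and β = 0. In the
  -- second relation, the quadratic and cubic terms then give δ̄α² = ρ and f_zz(0) = 0, and the
  -- quadratic term of the first gives γ = 0.
  have hi : (fun p => starRingEnd ℂ α * T.f p + starRingEnd ℂ γ * jet Ψ 0 1 (T.map p)) =ᶠ[𝓝 0]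
      fun p => (T.ρ : ℂ) * p.1 + 0 * p.2 := by
    filter_upwards [hfirst, hone, h.jet_one] with p e1 e2 e3
    have := e1.1
    rw [e2, e3] at this
    simp only [RigidTransformation.map] at this ⊢
    linear_combination this
  have hii : (fun p => starRingEnd ℂ β * T.f p + starRingEnd ℂ δ * jet Ψ 0 1 (T.map p)) =ᶠ[𝓝 0]
      fun p => (T.ρ : ℂ) * jet Φ 0 1 p + 0 * jet Φ 0 1 p := by
    filter_upwards [hfirst, hone] with p e1 e2
    have := e1.2
    rw [e2] at this
    simp only [RigidTransformation.map] at this ⊢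
    linear_combination this
  have hDT1 : ∀ v, pd v (fun p => jet Ψ 0 1 (T.map p)) 0 = 0 := by
    intro v
    have hu : AnalyticAt ℂ (jet Ψ 0 1) (T.f 0, T.g 0) := by rw [T.f_zero, T.g_zero]; exact hD'
    refine (pd_comp_pair hu T.f_analytic T.g_analytic _).trans ?_
    rw [T.f_zero, T.g_zero, Prod.mk_zero_zero, h'.pX_D, h'.pY_D.eq_of_nhds]
    ring
  have hαα : starRingEnd ℂ α * α = T.ρ := by
    have e := (pX_lin T.f_analytic hDT _ _).symm.trans
      ((pd_congr_at hi (1, 0)).trans (pX_lin analyticAt_fst analyticAt_snd _ _))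
    rw [show pX (fun p => jet Ψ 0 1 (T.map p)) 0 = 0 from hDT1 _, pX_fst] at e
    linear_combination e
  have hα0 : α ≠ 0 := by
    intro h0
    rw [h0, mul_zero] at hαα
    exact hρ hαα.symm
  have hα0' : starRingEnd ℂ α ≠ 0 := (map_ne_zero _).2 hα0
  have hβ0 : β = 0 := by
    have e := (pY_lin T.f_analytic hDT _ _).symm.trans
      ((pd_congr_at hi (0, 1)).trans (pY_lin analyticAt_fst analyticAt_snd _ _))
    rw [show pY (fun p => jet Ψ 0 1 (T.map p)) 0 = 0 from hDT1 _, pY_fst] at e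
    refine (mul_eq_zero.1 (?_ : starRingEnd ℂ α * β = 0)).resolve_left hα0'
    linear_combination e
  rw [hβ0, map_zero] at hii
  obtain ⟨hXX, hXXX⟩ := third_order_comp (T := T) hD' h'.pY_D h'.pX_D
  rw [h'.second_D h'.jet_two] at hXX hXXX
  rw [h'.third_D] at hXXX
  have hαδ : starRingEnd ℂ δ * α ^ 2 = T.ρ := by
    have e := (pXX_lin T.f_analytic hDT _ _).symm.trans
      ((iterate_pd_congr hii (1, 0) 2).eq_of_nhds.trans (pXX_lin hD hD _ _))
    rw [hXX, h.second_D h.jet_two] at e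
    linear_combination e
  have hδ0 : starRingEnd ℂ δ ≠ 0 := by
    intro h0
    rw [h0, zero_mul] at hαδ
    exact hρ hαδ.symm
  have hfXX : pX (pX T.f) 0 = 0 := by
    have e := (pXXX_lin T.f_analytic hDT _ _).symm.trans
      ((iterate_pd_congr hii (1, 0) 3).eq_of_nhds.trans (pXXX_lin hD hD _ _))
    rw [hXXX, h.third_D] at e
    refine (mul_eq_zero.1 (?_ : (starRingEnd ℂ δ * α) * pX (pX T.f) 0 = 0)).resolve_left
      (mul_ne_zero hδ0 hα0)
    linear_combination e / 3
  have hγ0 : γ = 0 := by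
    have e := (pXX_lin T.f_analytic hDT _ _).symm.trans
      ((iterate_pd_congr hi (1, 0) 2).eq_of_nhds.trans (pXX_lin analyticAt_fst analyticAt_snd _ _))
    rw [hXX, hfXX, show pX (pX fun p : ℂ × ℂ => p.1) 0 = _ from iterate_pd_fst 2 0] at e
    have h0 : starRingEnd ℂ γ = 0 := by
      refine (mul_eq_zero.1 (?_ : starRingEnd ℂ γ * α ^ 2 = 0)).resolve_right
        (pow_ne_zero 2 hα0)
      simpa using e
    simpa using h0
  have hf : T.f =ᶠ[𝓝 0] fun p => α * p.1 + 0 * p.2 := by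
    filter_upwards [hi] with p hp
    rw [hγ0, map_zero, ← hαα] at hp
    refine mul_left_cancel₀ hα0' ?_
    linear_combination hp
  have hfXXX : pX (pX (pX T.f)) 0 = 0 := by
    refine ((iterate_pd_congr hf (1, 0) 3).eq_of_nhds.trans
      (pXXX_lin analyticAt_fst analyticAt_snd _ _)).trans ?_
    rw [show pX (pX (pX fun p : ℂ × ℂ => p.1)) 0 = _ from iterate_pd_fst 3 0]
    simp
  have hfXY : pX (pY T.f) 0 = 0 := by
    have : pY T.f =ᶠ[𝓝 0] fun _ => 0 := by
      filter_upwards [pd_congr hf (0, 1)] with p hp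
      refine hp.trans ((pY_lin analyticAt_fst analyticAt_snd _ _).trans ?_)
      rw [pY_fst]; ring
    exact (pd_congr_const this _).eq_of_nhds
  have hsecond := hs.jet_second h.ext h'.ext hγ0
  rw [← hα, ← hβ, ← hδ, hβ0, hfXX, hfXY] at hsecond
  set κ := pX (pX T.g) 0 with hκ
  -- The C-relation with C = ζ and C' = ζ, where D' along the map is α²D. Only the multiple of D
  -- keeps g from being diagonal.
  have hg : (fun p => starRingEnd ℂ α ^ 2 * T.g p + 0 * T.g p) =ᶠ[𝓝 0]
      fun p => (T.ρ : ℂ) * p.2 + (-(α ^ 2 * starRingEnd ℂ κ)) * jet Φ 0 1 p := by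
    filter_upwards [hsecond, hii, T.eventually_map.2 h'.jet_two, h.jet_two] with p e1 e2 e3 e4
    have e5 := e1.1
    rw [e3, e4] at e5
    rw [← hαδ] at e2
    have e6 : jet Ψ 0 1 (T.map p) = α ^ 2 * jet Φ 0 1 p := by
      refine mul_left_cancel₀ hδ0 ?_
      linear_combination e2
    rw [e6, map_zero, mul_zero, add_zero] at e5
    simp only [RigidTransformation.map] at e5 ⊢
    linear_combination e5
  have hκre : starRingEnd ℂ α ^ 2 * κ + α ^ 2 * starRingEnd ℂ κ = 0 := by
    have e := (pXX_lin T.g_analytic T.g_analytic _ _).symm.trans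
      ((iterate_pd_congr hg (1, 0) 2).eq_of_nhds.trans (pXX_lin analyticAt_snd hD _ _))
    rw [h.second_D h.jet_two, show pX (pX fun p : ℂ × ℂ => p.2) 0 = _ from iterate_pd_snd 2 0,
      if_neg (by simp)] at e
    linear_combination e
  have hE' : (fun p => jet Ψ 1 1 (T.map p)) =ᶠ[𝓝 0]
      fun p => (α ^ 2 / starRingEnd ℂ α) * jet Φ 1 1 p
        + (-(α ^ 2 * starRingEnd ℂ (pX (pY T.g) 0) / (starRingEnd ℂ α * starRingEnd ℂ δ)))
          * jet Φ 0 1 p := by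
    filter_upwards [hsecond, hii] with p e1 e2
    rw [← hαδ] at e2
    have e6 : jet Ψ 0 1 (T.map p) = α ^ 2 * jet Φ 0 1 p := by
      refine mul_left_cancel₀ hδ0 ?_
      linear_combination e2
    have e5 := e1.2
    rw [e6, ← hαδ, mul_zero, map_zero, mul_zero, mul_zero, add_zero, zero_add, map_mul] at e5
    field_simp
    linear_combination e5
  have e7 := h'.third_E_comp h'.jet_two (T := T) hγ0 hfXX hfXXX
  have e8 := e7.symm.trans ((iterate_pd_congr hE' (1, 0) 3).eq_of_nhds.trans
    (pXXX_lin (analyticAt_jet h.ext.analytic 1 1) hD _ _))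
  rw [h.third_D, ← hα, ← hκ] at e8
  -- The zz-derivative of the C-relation makes ᾱ²κ purely imaginary. The zzz-derivative of the
  -- E-relation makes it real, because E_zzz(0) and E'_zzz(0) are real.
  have hκ0 : κ = 0 := by
    set s := pX (pX (pX (jet Ψ 1 1))) 0
    set t := pX (pX (pX (jet Φ 1 1))) 0
    have e9 : s * α ^ 2 * starRingEnd ℂ α ^ 2 + 3 * κ * starRingEnd ℂ α ^ 2 =
        α * starRingEnd ℂ α * t := by
      have : s * α ^ 3 + 3 * α * κ = α ^ 2 / starRingEnd ℂ α * t := by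
        linear_combination e8
      field_simp at this
      linear_combination starRingEnd ℂ α * this
    have e10 := congrArg (starRingEnd ℂ) e9
    simp only [map_add, map_mul, map_pow, Complex.conj_conj, show starRingEnd ℂ s = s from h'.third_E,
      show starRingEnd ℂ t = t from h.third_E,
      show starRingEnd ℂ (3 : ℂ) = 3 from Complex.conj_ofNat 3] at e10
    refine (mul_eq_zero.1 (?_ : starRingEnd ℂ α ^ 2 * κ = 0)).resolve_left (pow_ne_zero 2 hα0')
    linear_combination hκre / 2 + (e9 - e10) / 6
  refine ⟨α, hα0, by rw [← hαα]; ring, ?_, ?_⟩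
  · filter_upwards [hf] with p hp
    rw [hp]; ring
  · filter_upwards [hg] with p hp
    rw [hκ0, map_zero, ← hαα] at hp
    refine mul_left_cancel₀ hα0' ?_
    linear_combination hp

end RigidCR

end

/-! ### The theorem -/

theorem theorem10p10 :
    (∀ F : ℂ × ℂ → ℝ, RigidCR.MemH F →
      (∃ (T : RigidCR.RigidTransformation) (G : ℂ × ℂ → ℝ),
        RigidCR.MemH7 G ∧ T.Sends F G) ∧
      (∀ (T : RigidCR.RigidTransformation) (G : ℂ × ℂ → ℝ),
        RigidCR.MemH7 G → T.Sends F G →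
          ∃ (T' : RigidCR.RigidTransformation) (G' : ℂ × ℂ → ℝ),
            RigidCR.MemH7 G' ∧ T'.Sends F G' ∧ ¬ T.SameGerm T')) ∧
    (∀ (F F' : ℂ × ℂ → ℝ) (T : RigidCR.RigidTransformation),
      RigidCR.MemH7 F → RigidCR.MemH7 F' → T.Sends F F' →
        ∃ r θ : ℝ, 0 < r ∧
          (∀ᶠ p in 𝓝 (0 : ℂ × ℂ), T.f p = r * Complex.exp (θ * Complex.I) * p.1) ∧
          (∀ᶠ p in 𝓝 (0 : ℂ × ℂ), T.g p = Complex.exp (2 * θ * Complex.I) * p.2) ∧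
          T.ρ = r ^ 2) := by
  refine ⟨fun F hF => ⟨hF.exists_memH7, fun T G hG hs => ?_⟩, fun F F' T hF hF' hs => ?_⟩
  · obtain ⟨Ψ, hΨ⟩ := hG.exists_isNormal
    obtain ⟨S, K, hK, hSK, hSρ⟩ := hΨ.exists_dilate
    obtain ⟨R, hR, -, -, hRρ⟩ := hs.exists_comp hSK
    -- The composite with the dilation has scale factor 4ρ, which differs from ρ since ρ ≠ 0.
    refine ⟨R, K, hK, hR, fun hsame => ?_⟩
    have h1 := hsame.2.2
    rw [hRρ, hSρ] at h1
    exact T.ρ_ne_zero (by linarith)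
  · obtain ⟨Φ, hΦ⟩ := hF.exists_isNormal
    obtain ⟨Ψ, hΨ⟩ := hF'.exists_isNormal
    obtain ⟨α, hα, hρ, hf, hg⟩ := hΦ.sends_eq hΨ hs
    have hr : 0 < ‖α‖ := norm_pos_iff.2 hα
    have hpolar : (‖α‖ : ℂ) * Complex.exp (α.arg * Complex.I) = α := Complex.norm_mul_exp_arg_mul_I α
    refine ⟨‖α‖, α.arg, hr, ?_, ?_, ?_⟩
    · filter_upwards [hf] with p hp
      rw [hp, hpolar]
    -- With α = re^{iθ}, the factor α/ᾱ is e^{2iθ}.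
    · have hsq : starRingEnd ℂ α * Complex.exp (2 * α.arg * Complex.I) = α := by
        have h1 : Complex.exp (2 * α.arg * Complex.I) =
            Complex.exp (α.arg * Complex.I) * Complex.exp (α.arg * Complex.I) := by
          rw [← Complex.exp_add]; ring_nf
        have h2 : (‖α‖ : ℂ) ≠ 0 := by exact_mod_cast hr.ne'
        have h3 : α * starRingEnd ℂ α = (‖α‖ : ℂ) ^ 2 := Complex.mul_conj' α
        refine mul_left_cancel₀ (pow_ne_zero 2 h2) ?_
        calc (‖α‖ : ℂ) ^ 2 * (starRingEnd ℂ α * Complex.exp (2 * α.arg * Complex.I))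
            = starRingEnd ℂ α * ((‖α‖ : ℂ) * Complex.exp (α.arg * Complex.I)) ^ 2 := by
              rw [h1]; ring
          _ = (‖α‖ : ℂ) ^ 2 * α := by rw [hpolar, ← h3]; ring
      filter_upwards [hg] with p hp
      refine mul_left_cancel₀ ((map_ne_zero (starRingEnd ℂ)).2 hα) ?_
      rw [hp, ← mul_assoc, hsq]
    · rw [Complex.mul_conj'] at hρ
      exact_mod_cast hρ
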